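/- **Theorem (data-driven closed-loop system).** Consider the parabolic system $$\dot x(z,t)=\rho x''(z,t)+a(z)x(z,t),\quad x'(0,t)=q_0x(0,t)+u_1(t),\quad x'(1,t)=q_1x(1,t)+u_2(t),$$ for $z\in(0,1)$, $t>0$, with $\rho>0$, $a\in C[0,1]$ real, $q_0,q_1\in\mathbb R$, inputs $u=(u_1,u_2)^\top$ and state space $X=L_2(0,1)$ with norm $\|\cdot\|$ and inner product $\langle x,y\rangle=\int_0^1x\bar y$. Let $\mathcal A h=\rho h''+ah$ with $D(\mathcal A)=\{h\in H^2(0,1): h'(0)=q_0h(0),\ h'(1)=q_1h(1)\}$, let $\lambda_1>\lambda_2>\dots$ be all its eigenvalues, $\phi_i$ corresponding real eigenvectors of unit norm, $\varphi_i[x]=\langle x,\phi_i\rangle$, and $b_i=\rho\,(-\phi_i(0),\phi_i(1))^\top$. Fix $n\ge1$ and put $\underline\varphi_n[x]=(\varphi_1[x],\dots,\varphi_n[x])^\top$, $\Lambda_n=\operatorname{diag}(\lambda_1,\dots,\lambda_n)$, and let $B_n\in\mathbb R^{n\times2}$ be the matrix with rows $b_i^\top$, $i\le n$. Let real estimates $\hat\lambda_i\in\mathbb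 R$, $\hat\phi_i\in L_2(0,1)$ (real functions with given values at $0$ and $1$), $i=1,\dots,n$, and $\hat\rho\in\mathbb R$ be given, for example by dynamic mode decomposition (DMD) and interpolation. Put $\hat\Lambda_n=\operatorname{diag}(\hat\lambda_1,\dots,\hat\lambda_n)$, let $\hat B_n$ be the matrix with rows $\hat\rho\,(-\hat\phi_i(0),\hat\phi_i(1))$, and put $\hat{\underline\varphi}_n[x]=(\langle x,\hat\phi_1\rangle,\dots,\langle x,\hat\phi_n\rangle)^\top$, $\epsilon_\lambda=\|\Lambda_n-\hat\Lambda_n\|$, $\epsilon_B=\|B_n-\hat B_n\|$ (matrix norms are spectral norms). Let $K\in\mathbb R^{2\times n}$ be such that $\hat\Lambda_n-\hat B_nK$ is Hurwitz, let $\Pi$ be the positive definite solution of $$(\hat\Lambda_n-\hat B_nK)^\top\Pi+\Pi(\hat\Lambda_n-\hat B_nK)=-I$$ with largest eigenvalue $\lambda_{\max}(\Pi)$, and let $c_\phi>0$ be such that $\|\underline\varphi_n[x]-\hat{\underline\varphi}_n[x]\|_{\mathbb C^n}\le c_\phi\|\underline\varphi_n[x]\|_{\mathbb C^n}$ for all $x\in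 X$. Put $$\gamma=2\big((\epsilon_\lambda+\epsilon_B\|K\|)\lambda_{\max}(\Pi)+c_\phi\|\Pi B_nK\|\big)-1,\qquad \hat\alpha=\frac{\gamma}{2\lambda_{\max}(\Pi)},$$ and assume that $\lambda_i<\hat\alpha<0$ for all $i>n$. Then the closed loop with the data-driven feedback $u(t)=-K\hat{\underline\varphi}_n[x(t)]$ is exponentially stable in $L_2$ with rate $\hat\alpha$: there is $\hat M_x\ge1$ such that for every $x_0\in X$ there is exactly one continuous $x:[0,\infty)\to X$ with $x(0)=x_0$ that satisfies the modal equations $$\tfrac{d}{dt}\varphi_i[x(t)]=\lambda_i\varphi_i[x(t)]+b_i^\top u(t),\qquad t>0,\ i\in\mathbb N,$$ this $x$ is also a weak solution of the closed-loop parabolic system, i.e. $\frac{d}{dt}\langle x(t),h\rangle=\langle x(t),\mathcal Ah\rangle+\rho\,(h(1)u_2(t)-h(0)u_1(t))$ for $t>0$ and all real-valued $h\in D(\mathcal A)$, and $$\|x(t)\|\le\hat M_x\,e^{\hat\alpha t}\,\|x_0\|,\qquad t\ge0.$$ -/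

import Mathlib

open MeasureTheory
open scoped Matrix.Norms.L2Operator

noncomputable section

/-- The state space `X = L_2(0,1)` of complex-valued square integrable functions. -/
abbrev StateSpace : Type := Lp ℂ 2 (volume.restrict (Set.Ioo (0 : ℝ) 1))

/-- The observable `x ↦ ⟨x, φ⟩ = ∫₀¹ x(z) φ(z) dz` belonging to a real-valued function `φ`. -/
def functional (phi : ℝ → ℝ) (x : StateSpace) : ℂ :=
  ∫ z in Set.Ioo (0 : ℝ) 1, x z * (phi z : ℂ)

/-- The vector of observables `col(⟨x, φ_1⟩, …, ⟨x, φ_n⟩)` in `ℂⁿ` with the Euclidean norm. -/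
def functionalVec {n : ℕ} (phi : Fin n → ℝ → ℝ) (x : StateSpace) : EuclideanSpace ℂ (Fin n) :=
  WithLp.toLp 2 fun i => functional (phi i) x

/-- Data of the boundary controlled parabolic system
`∂ₜ x(z,t) = ρ x''(z,t) + a(z) x(z,t)` on `(0,1)`,
`x'(0,t) = q₀ x(0,t) + u₁(t)`, `x'(1,t) = q₁ x(1,t) + u₂(t)`. -/
structure ParabolicPlant where
  rho : ℝ
  a : ℝ → ℝ
  q0 : ℝ
  q1 : ℝ
  rho_pos : 0 < rho
  a_cont : ContinuousOn a (Set.Icc 0 1)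

/-- `h` (real-valued) belongs to `H²(0,1)`, with first derivative `dh` and weak second
derivative `ddh`: `h` and `dh` are the (absolutely) continuous representatives on `[0,1]`,
i.e. the primitives of `dh` and `ddh`, and `ddh` is square integrable. -/
structure IsH2 (h dh ddh : ℝ → ℝ) : Prop where
  memLp : MemLp ddh 2 (volume.restrict (Set.Ioo (0 : ℝ) 1))
  eq_integral : ∀ z ∈ Set.Icc (0 : ℝ) 1, h z = h 0 + ∫ s in (0 : ℝ)..z, dh s
  deriv_eq_integral : ∀ z ∈ Set.Icc (0 : ℝ) 1, dh z = dh 0 + ∫ s in (0 : ℝ)..z, ddh s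

namespace ParabolicPlant

/-- `h ∈ D(𝒜) = {h ∈ H²(0,1) | h'(0) = q₀ h(0), h'(1) = q₁ h(1)}` (real-valued elements; as
the coefficients are real, the complex domain consists of the `h₁ + i h₂` with such `h₁, h₂`). -/
structure InDomain (P : ParabolicPlant) (h dh ddh : ℝ → ℝ) : Prop extends IsH2 h dh ddh where
  bc0 : dh 0 = P.q0 * h 0
  bc1 : dh 1 = P.q1 * h 1

/-- `𝒜 h = ρ h'' + a h`. -/
def opA (P : ParabolicPlant) (h ddh : ℝ → ℝ) : ℝ → ℝ := fun z => P.rho * ddh z + P.a z * h z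

/-- `φ` is a (real-valued) eigenvector of `𝒜` for the eigenvalue `mu`. -/
def IsEigenfunction (P : ParabolicPlant) (mu : ℝ) (phi : ℝ → ℝ) : Prop :=
  ∃ dphi ddphi : ℝ → ℝ, P.InDomain phi dphi ddphi ∧
    (∀ᵐ z ∂(volume.restrict (Set.Ioo (0 : ℝ) 1)), P.opA phi ddphi z = mu * phi z) ∧
    ∃ z ∈ Set.Icc (0 : ℝ) 1, phi z ≠ 0

/-- `lam 0 > lam 1 > …` is the list of all eigenvalues of `𝒜` and `phi i` is an eigenvector of
unit norm for `lam i`. (Indices start at `0`.) -/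
structure IsEigensystem (P : ParabolicPlant) (lam : ℕ → ℝ) (phi : ℕ → ℝ → ℝ) : Prop where
  strictAnti : StrictAnti lam
  eigenfunction : ∀ i, P.IsEigenfunction (lam i) (phi i)
  normalized : ∀ i, ∫ z in Set.Ioo (0 : ℝ) 1, phi i z ^ 2 = 1
  exhaustive : ∀ mu phi', P.IsEigenfunction mu phi' → ∃ i, lam i = mu

end ParabolicPlant

/-- The input vector `ρ col(-φ(0), φ(1))`. -/
def inputVec (rho : ℝ) (phi : ℝ → ℝ) : Fin 2 → ℝ := ![-(rho * phi 0), rho * phi 1]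

/-- The input matrix with the rows `ρ [-φ_i(0), φ_i(1)]`, `i = 1, …, n`. -/
def inputMatrix {n : ℕ} (rho : ℝ) (phi : Fin n → ℝ → ℝ) : Matrix (Fin n) (Fin 2) ℝ :=
  Matrix.of fun i => inputVec rho (phi i)

/-- The state feedback `u = -K col(⟨x, ψ_1⟩, …, ⟨x, ψ_n⟩)`. -/
def feedback {n : ℕ} (K : Matrix (Fin 2) (Fin n) ℝ) (psi : Fin n → ℝ → ℝ) (x : StateSpace) :
    Fin 2 → ℂ :=
  fun k => -∑ j, (K k j : ℂ) * functional (psi j) x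

/-- `x : [0,∞) → X` is the (weak) solution, with initial value `x0`, of the parabolic system
closed by the feedback `u(t) = -K col(⟨x(t), ψ_1⟩, …, ⟨x(t), ψ_n⟩)`: it is continuous and
`d/dt ⟨x, h⟩ = ⟨x, 𝒜h⟩ + ρ (h(1) u₂ - h(0) u₁)`, `t > 0`, for all `h ∈ D(𝒜)`. This is the
differential equation with its boundary conditions after two integrations by parts. -/
structure IsWeakSolution {n : ℕ} (P : ParabolicPlant) (K : Matrix (Fin 2) (Fin n) ℝ)
    (psi : Fin n → ℝ → ℝ) (x0 : StateSpace) (x : ℝ → StateSpace) : Prop where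
  initial : x 0 = x0
  continuousOn : ContinuousOn x (Set.Ici 0)
  weak : ∀ h dh ddh : ℝ → ℝ, P.InDomain h dh ddh → ∀ t : ℝ, 0 < t →
    HasDerivAt (fun s => functional h (x s))
      (functional (P.opA h ddh) (x t)
        + ∑ k, (inputVec P.rho h k : ℂ) * feedback K psi (x t) k) t

/-- `x : [0,∞) → X` solves, with initial value `x0`, the modal equations
`d/dt φ_i[x] = λ_i φ_i[x] + b_iᵀ u`, `t > 0`, for all `i`, where `b_i = ρ col(-φ_i(0), φ_i(1))`
and `u(t) = -K col(⟨x(t), ψ_1⟩, …, ⟨x(t), ψ_n⟩)`. -/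
structure IsModalSolution {n : ℕ} (P : ParabolicPlant) (lam : ℕ → ℝ) (phi : ℕ → ℝ → ℝ)
    (K : Matrix (Fin 2) (Fin n) ℝ) (psi : Fin n → ℝ → ℝ) (x0 : StateSpace)
    (x : ℝ → StateSpace) : Prop where
  initial : x 0 = x0
  continuousOn : ContinuousOn x (Set.Ici 0)
  modal : ∀ i : ℕ, ∀ t : ℝ, 0 < t →
    HasDerivAt (fun s => functional (phi i) (x s))
      ((lam i : ℂ) * functional (phi i) (x t)
        + ∑ k, (inputVec P.rho (phi i) k : ℂ) * feedback K psi (x t) k) t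

/-- A real square matrix is Hurwitz if all its complex eigenvalues have negative real part. -/
def IsHurwitz {n : ℕ} (A : Matrix (Fin n) (Fin n) ℝ) : Prop :=
  ∀ mu ∈ spectrum ℂ (A.map (fun r : ℝ => (r : ℂ))), mu.re < 0

/-- The largest (real) eigenvalue. -/
def lambdaMax {n : ℕ} (A : Matrix (Fin n) (Fin n) ℝ) : ℝ := sSup (spectrum ℝ A)

/-- `γ = 2((ε_λ + ε_B‖K‖) λ_max(Π) + c_φ‖Π B K‖) - 1` with `ε_λ = ‖Λ - Λ̂‖` and
`ε_B = ‖B - B̂‖`; all matrix norms are spectral norms. -/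
def gammaConst {n : ℕ} (L Lhat : Matrix (Fin n) (Fin n) ℝ) (B Bhat : Matrix (Fin n) (Fin 2) ℝ)
    (K : Matrix (Fin 2) (Fin n) ℝ) (Pi : Matrix (Fin n) (Fin n) ℝ) (c : ℝ) : ℝ :=
  2 * ((‖L - Lhat‖ + ‖B - Bhat‖ * ‖K‖) * lambdaMax Pi + c * ‖Pi * B * K‖) - 1

end

noncomputable section

/-! The bound on the estimated observables is relative: they vanish wherever the first n modal
coordinates vanish, so they factor through these coordinates by an n×n matrix S
(`functionalVec_eq_estimateMap`). The feedback therefore sees only the first n modes, and the closed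
loop is a cascade: the autonomous system p' = (Λ - BKS)p drives every remaining mode separately.

For p, take V(v) = v*Πv and split Λ - BKS into the nominal part Λ̂ - B̂K, the parameter error (Λ -
Λ̂) - (B - B̂)K, and BK(1 - S). The Lyapunov equation and norm bounds give V' ≤ γ|v|²
(`lyapunov_inequality`). Since α < 0 and V ≤ λ_max|v|², this yields V' ≤ 2αV and decay at rate α
(`exists_decay_of_lyapunov`).

For a mode i outside the first n, variation of constants gives a bound of size ‖b_i‖/(α - λ_i) times
e^{αt} (`norm_varConst_le`). The control acts on the boundary, so ℓ² control of these quotients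
needs an argument: Green's identity with polynomials g_k lifting the boundary inputs gives b_{ik} =
⟨ρg_k'' + ag_k, φ_i⟩ - λ_i⟨g_k, φ_i⟩. The quotients are then square summable, and the modes assemble
into a decaying curve in X (`HilbertBasis.exists_modal_trajectory`). The same formula justifies
termwise differentiation of ⟨x, h⟩, which is the weak equation (`HilbertBasis.hasDerivAt_inner`).

The modal expansion requires the φ_i to be complete. For μ not an eigenvalue, the problem (𝒜 - μ)h =
f becomes identity plus compact for the unknowns (h'', h(0)). The Fredholm alternative gives a
compact, symmetric, injective resolvent, and the spectral theorem applies to it. Simplicity of the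
eigenvalues identifies its eigenvectors with multiples of the φ_i
(`IsEigensystem.eq_zero_of_forall_integral`).

Uniqueness: the decay estimate with zero initial value fixes the first n modes, and each scalar
modal equation then has a known input. -/

/-- Lebesgue measure on `(0,1)`. -/
abbrev unitVol : Measure ℝ := volume.restrict (Set.Ioo (0 : ℝ) 1)

/-! ### Integrals, primitives and integration by parts on [0,1]. -/

theorem intervalIntegrable_of_integrable_unitVol {f : ℝ → ℝ} (hf : Integrable f unitVol) :
    IntervalIntegrable f volume 0 1 := by
  rw [intervalIntegrable_iff_integrableOn_Ioc_of_le zero_le_one, integrableOn_Ioc_iff_integrableOn_Ioo]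
  exact hf

theorem ContinuousOn.integrable_unitVol {f : ℝ → ℝ} (hf : ContinuousOn f (Set.Icc 0 1)) :
    Integrable f unitVol :=
  (hf.integrableOn_compact isCompact_Icc).mono_set Set.Ioo_subset_Icc_self

theorem ContinuousOn.memLp_unitVol {f : ℝ → ℝ} (hf : ContinuousOn f (Set.Icc 0 1)) :
    MemLp f 2 unitVol := by
  obtain ⟨C, hC⟩ := isCompact_Icc.exists_bound_of_continuousOn hf
  refine MemLp.of_bound hf.integrable_unitVol.aestronglyMeasurable C ?_
  filter_upwards [ae_restrict_mem measurableSet_Ioo] with z hz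
  exact hC z (Set.Ioo_subset_Icc_self hz)

theorem integral_unitVol (f : ℝ → ℝ) : ∫ z, f z ∂unitVol = ∫ z in (0 : ℝ)..1, f z := by
  rw [intervalIntegral.integral_of_le zero_le_one, integral_Ioc_eq_integral_Ioo]

theorem intervalIntegral_congr_unitVol {f g : ℝ → ℝ} (h : f =ᵐ[unitVol] g) {z : ℝ}
    (hz : z ∈ Set.Icc (0 : ℝ) 1) : ∫ s in (0 : ℝ)..z, f s = ∫ s in (0 : ℝ)..z, g s := by
  rw [intervalIntegral.integral_of_le hz.1, intervalIntegral.integral_of_le hz.1,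
    integral_Ioc_eq_integral_Ioo, integral_Ioc_eq_integral_Ioo]
  exact integral_congr_ae
    (ae_mono (Measure.restrict_mono (Set.Ioo_subset_Ioo_right hz.2) le_rfl) h)

theorem uIcc_zero_one : Set.uIcc (0 : ℝ) 1 = Set.Icc 0 1 := Set.uIcc_of_le zero_le_one

theorem continuousOn_of_eq_primitive {F f : ℝ → ℝ} (hf : IntervalIntegrable f volume 0 1)
    (hF : ∀ z ∈ Set.Icc (0 : ℝ) 1, F z = F 0 + ∫ s in (0 : ℝ)..z, f s) :
    ContinuousOn F (Set.Icc 0 1) := by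
  have h := intervalIntegral.continuousOn_primitive_interval (μ := volume) (f := f) (a := 0) (b := 1)
    (by rw [uIcc_zero_one]; exact (intervalIntegrable_iff_integrableOn_Icc_of_le zero_le_one).1 hf)
  rw [uIcc_zero_one] at h
  exact (continuousOn_const.add h).congr hF

/-- Integration by parts for primitives of integrable functions on `[0,1]`. -/
theorem integral_primitive_mul {F f G g : ℝ → ℝ} (hf : IntervalIntegrable f volume 0 1)
    (hg : IntervalIntegrable g volume 0 1)
    (hF : ∀ z ∈ Set.Icc (0 : ℝ) 1, F z = F 0 + ∫ s in (0 : ℝ)..z, f s)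
    (hG : ∀ z ∈ Set.Icc (0 : ℝ) 1, G z = G 0 + ∫ s in (0 : ℝ)..z, g s) :
    ∫ z in (0 : ℝ)..1, (f z * G z + F z * g z) = F 1 * G 1 - F 0 * G 0 := by
  have key : ∀ {F f : ℝ → ℝ}, IntervalIntegrable f volume 0 1 →
      AbsolutelyContinuousOnInterval (fun z => F 0 + ∫ s in (0 : ℝ)..z, f s) 0 1 := by
    intro F f hf
    have h1 := hf.absolutelyContinuousOnInterval_intervalIntegral (c := 0) (by simp)
    -- Absolute continuity is a limit statement about sums of distances, which the added constant `F
    -- 0` leaves unchanged.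
    refine Filter.Tendsto.congr ?_ h1
    intro E
    simp
  have h := (key (F := F) hf).integral_deriv_mul_eq_sub (key (F := G) hg)
  rw [← hF 1 (by simp), ← hG 1 (by simp)] at h
  simp only [intervalIntegral.integral_same, add_zero] at h
  rw [← h]
  apply intervalIntegral.integral_congr_ae
  filter_upwards [hf.ae_hasDerivAt_integral, hg.ae_hasDerivAt_integral] with z hz1 hz2 hz
  have hz' : z ∈ Set.uIcc (0 : ℝ) 1 := Set.uIoc_subset_uIcc hz
  have e1 := ((hz1 hz' 0 (by simp)).const_add (F 0)).deriv
  have e2 := ((hz2 hz' 0 (by simp)).const_add (G 0)).deriv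
  rw [e1, e2, ← hF z (by rwa [uIcc_zero_one] at hz'), ← hG z (by rwa [uIcc_zero_one] at hz')]

/-- A primitive is known only on [0,1], so only the right derivative is available at 0. This is the
form in which the Grönwall uniqueness argument consumes it. -/
theorem hasDerivWithinAt_of_eq_primitive {F f : ℝ → ℝ} (hf : ContinuousOn f (Set.Icc 0 1))
    (hF : ∀ z ∈ Set.Icc (0 : ℝ) 1, F z = F 0 + ∫ s in (0 : ℝ)..z, f s) {x : ℝ}
    (hx : x ∈ Set.Ico (0 : ℝ) 1) : HasDerivWithinAt F (f x) (Set.Ici x) x := by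
  have hint : IntervalIntegrable f volume 0 x :=
    (hf.mono (Set.Icc_subset_Icc_right hx.2.le)).intervalIntegrable_of_Icc hx.1
  have hmem : Set.Icc (0 : ℝ) 1 ∈ nhdsWithin x (Set.Ioi x) :=
    Filter.mem_of_superset (Ioo_mem_nhdsGT hx.2)
      fun y hy => ⟨hx.1.trans hy.1.le, hy.2.le⟩
  have hx' : x ∈ Set.Icc (0 : ℝ) 1 := ⟨hx.1, hx.2.le⟩
  have h := intervalIntegral.integral_hasDerivWithinAt_right hint
    (s := Set.Ici x) (t := Set.Ioi x)
    ⟨Set.Icc 0 1, hmem, hf.aestronglyMeasurable measurableSet_Icc⟩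
    ((hf x hx').mono_of_mem_nhdsWithin hmem)
  refine (h.const_add (F 0)).congr_of_eventuallyEq ?_ (hF x hx')
  filter_upwards [Icc_mem_nhdsGE hx.2] with y hy
  exact hF y ⟨hx.1.trans hy.1, hy.2⟩

/-! ### Regularity of H² functions. -/

namespace IsH2

variable {h dh ddh k dk ddk : ℝ → ℝ}

theorem intervalIntegrable_ddh (H : IsH2 h dh ddh) : IntervalIntegrable ddh volume 0 1 :=
  intervalIntegrable_of_integrable_unitVol (H.memLp.integrable one_le_two)

theorem continuousOn_dh (H : IsH2 h dh ddh) : ContinuousOn dh (Set.Icc 0 1) :=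
  continuousOn_of_eq_primitive H.intervalIntegrable_ddh H.deriv_eq_integral

theorem intervalIntegrable_dh (H : IsH2 h dh ddh) : IntervalIntegrable dh volume 0 1 :=
  H.continuousOn_dh.intervalIntegrable_of_Icc zero_le_one

theorem continuousOn (H : IsH2 h dh ddh) : ContinuousOn h (Set.Icc 0 1) :=
  continuousOn_of_eq_primitive H.intervalIntegrable_dh H.eq_integral

theorem linear_comb (H : IsH2 h dh ddh) (H' : IsH2 k dk ddk) (c d : ℝ) :
    IsH2 (fun z => c * h z + d * k z) (fun z => c * dh z + d * dk z)
      (fun z => c * ddh z + d * ddk z) := by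
  have sub : ∀ {z : ℝ}, z ∈ Set.Icc (0 : ℝ) 1 → Set.uIcc 0 z ⊆ Set.uIcc 0 1 := by
    intro z hz
    rw [uIcc_zero_one, Set.uIcc_of_le hz.1]
    exact Set.Icc_subset_Icc_right hz.2
  refine ⟨(H.memLp.const_mul c).add (H'.memLp.const_mul d), fun z hz => ?_, fun z hz => ?_⟩
  · rw [intervalIntegral.integral_add ((H.intervalIntegrable_dh.mono_set (sub hz)).const_mul c)
      ((H'.intervalIntegrable_dh.mono_set (sub hz)).const_mul d),
      intervalIntegral.integral_const_mul, intervalIntegral.integral_const_mul,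
      H.eq_integral z hz, H'.eq_integral z hz]
    ring
  · rw [intervalIntegral.integral_add ((H.intervalIntegrable_ddh.mono_set (sub hz)).const_mul c)
      ((H'.intervalIntegrable_ddh.mono_set (sub hz)).const_mul d),
      intervalIntegral.integral_const_mul, intervalIntegral.integral_const_mul,
      H.deriv_eq_integral z hz, H'.deriv_eq_integral z hz]
    ring

end IsH2

/-! ### Green's identity, simplicity of eigenvalues and orthogonality. -/

namespace ParabolicPlant

variable {P : ParabolicPlant} {h dh ddh k dk ddk : ℝ → ℝ}

theorem memLp_opA (P : ParabolicPlant) (H : IsH2 h dh ddh) : MemLp (P.opA h ddh) 2 unitVol :=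
  (H.memLp.const_mul P.rho).add (P.a_cont.mul H.continuousOn).memLp_unitVol

/-- Green's identity. -/
theorem integral_opA_sub (P : ParabolicPlant) (H : IsH2 h dh ddh) (H' : IsH2 k dk ddk) :
    ∫ z, P.opA h ddh z * k z ∂unitVol - ∫ z, h z * P.opA k ddk z ∂unitVol =
      P.rho * ((dh 1 * k 1 - h 1 * dk 1) - (dh 0 * k 0 - h 0 * dk 0)) := by
  have i1 := H.intervalIntegrable_ddh.mul_continuousOn
    (uIcc_zero_one ▸ H'.continuousOn)
  have i2 := H'.intervalIntegrable_ddh.continuousOn_mul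
    (uIcc_zero_one ▸ H.continuousOn)
  have i3 : IntervalIntegrable (fun z => dh z * dk z) volume 0 1 :=
    (H.continuousOn_dh.mul H'.continuousOn_dh).intervalIntegrable_of_Icc zero_le_one
  have i4 : IntervalIntegrable (fun z => P.a z * (h z * k z)) volume 0 1 :=
    (P.a_cont.mul (H.continuousOn.mul H'.continuousOn)).intervalIntegrable_of_Icc zero_le_one
  have e1 := integral_primitive_mul H.intervalIntegrable_ddh H'.intervalIntegrable_dh
    H.deriv_eq_integral H'.eq_integral
  have e2 := integral_primitive_mul H.intervalIntegrable_dh H'.intervalIntegrable_ddh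
    H.eq_integral H'.deriv_eq_integral
  rw [intervalIntegral.integral_add i1 i3] at e1
  rw [intervalIntegral.integral_add i3 i2] at e2
  have e3 : ∫ z, P.opA h ddh z * k z ∂unitVol =
      P.rho * (∫ z in (0 : ℝ)..1, ddh z * k z) + ∫ z in (0 : ℝ)..1, P.a z * (h z * k z) := by
    rw [integral_unitVol, ← intervalIntegral.integral_const_mul,
      ← intervalIntegral.integral_add (i1.const_mul _) i4]
    congr 1 with z
    simp only [opA]; ring
  have e4 : ∫ z, h z * P.opA k ddk z ∂unitVol =
      P.rho * (∫ z in (0 : ℝ)..1, h z * ddk z) + ∫ z in (0 : ℝ)..1, P.a z * (h z * k z) := by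
    rw [integral_unitVol, ← intervalIntegral.integral_const_mul,
      ← intervalIntegral.integral_add (i2.const_mul _) i4]
    congr 1 with z
    simp only [opA]; ring
  rw [e3, e4]
  linear_combination P.rho * e1 - P.rho * e2

/-- The boundary terms of Green's identity cancel because both functions satisfy the same Robin
conditions. -/
theorem integral_opA_symm (H : P.InDomain h dh ddh) (H' : P.InDomain k dk ddk) :
    ∫ z, P.opA h ddh z * k z ∂unitVol = ∫ z, h z * P.opA k ddk z ∂unitVol := by
  have := P.integral_opA_sub H.toIsH2 H'.toIsH2
  rw [H.bc0, H.bc1, H'.bc0, H'.bc1] at this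
  linear_combination this

/-- A solution of the eigenvalue equation with vanishing Cauchy data at `0` vanishes. -/
theorem eq_zero_of_cauchy_data {mu : ℝ} (H : IsH2 h dh ddh)
    (heq : ∀ᵐ z ∂unitVol, P.opA h ddh z = mu * h z) (h0 : h 0 = 0) (h1 : dh 0 = 0) :
    ∀ z ∈ Set.Icc (0 : ℝ) 1, h z = 0 := by
  set q : ℝ → ℝ := fun z => (mu - P.a z) / P.rho with hq
  have hρ := P.rho_pos.ne'
  have hqc : ContinuousOn q (Set.Icc 0 1) := (continuousOn_const.sub P.a_cont).div_const _
  have hdd : ∀ᵐ z ∂unitVol, ddh z = q z * h z := by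
    filter_upwards [heq] with z hz
    simp only [opA] at hz
    rw [hq]; field_simp; linear_combination hz
  have hdh : ∀ z ∈ Set.Icc (0 : ℝ) 1, dh z = dh 0 + ∫ s in (0 : ℝ)..z, q s * h s := by
    intro z hz
    rw [H.deriv_eq_integral z hz, intervalIntegral_congr_unitVol hdd hz]
  obtain ⟨C, hC⟩ := isCompact_Icc.exists_bound_of_continuousOn hqc
  -- Grönwall for the pair (h, h') in the sup norm: its derivative (h', q h) is bounded by `max 1 C`
  -- times the pair.
  have hpair := eq_zero_of_abs_deriv_le_mul_abs_self_of_eq_zero_right (a := 0) (b := 1)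
    (f := fun z => (h z, dh z)) (f' := fun z => (dh z, q z * h z)) (K := max 1 C)
    (H.continuousOn.prodMk H.continuousOn_dh)
    (fun x hx => (hasDerivWithinAt_of_eq_primitive H.continuousOn_dh H.eq_integral hx).prodMk
      (hasDerivWithinAt_of_eq_primitive (hqc.mul H.continuousOn) hdh hx))
    (by simp [h0, h1])
    (fun x hx => by
      have hx' : x ∈ Set.Icc (0 : ℝ) 1 := ⟨hx.1, hx.2.le⟩
      rw [Prod.norm_def, Prod.norm_def]
      refine max_le ?_ ?_
      · calc ‖dh x‖ = 1 * ‖dh x‖ := (one_mul _).symm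
          _ ≤ max 1 C * max ‖h x‖ ‖dh x‖ :=
            mul_le_mul (le_max_left _ _) (le_max_right _ _) (norm_nonneg _) (by positivity)
      · rw [norm_mul]
        exact mul_le_mul ((hC x hx').trans (le_max_right _ _)) (le_max_left _ _) (norm_nonneg _)
          (by positivity))
  intro z hz
  exact congrArg Prod.fst (hpair z hz)

/-- The eigenvalues of `𝒜` are simple. -/
theorem IsEigenfunction.exists_eq_mul {mu : ℝ} {phi psi : ℝ → ℝ} (hphi : P.IsEigenfunction mu phi)
    (hpsi : P.IsEigenfunction mu psi) : ∃ c : ℝ, ∀ z ∈ Set.Icc (0 : ℝ) 1, psi z = c * phi z := by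
  obtain ⟨dphi, ddphi, H, he, z0, hz0, hne⟩ := hphi
  obtain ⟨dpsi, ddpsi, H', he', -⟩ := hpsi
  -- By the boundary condition at 0, `phi 0 = 0` would also force `dphi 0 = 0`, hence vanishing
  -- Cauchy data. So `psi 0 / phi 0` is a legitimate factor.
  have hphi0 : phi 0 ≠ 0 := fun h0 =>
    hne (eq_zero_of_cauchy_data H.toIsH2 he h0 (by rw [H.bc0, h0, mul_zero]) z0 hz0)
  refine ⟨psi 0 / phi 0, fun z hz => ?_⟩
  have := eq_zero_of_cauchy_data (P := P) (mu := mu)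
    (H'.toIsH2.linear_comb H.toIsH2 1 (-(psi 0 / phi 0))) (by
      filter_upwards [he, he'] with z h1 h2
      simp only [opA] at h1 h2 ⊢
      linear_combination h2 - psi 0 / phi 0 * h1) (by field_simp; ring)
    (by rw [H.bc0, H'.bc0]; field_simp; ring) z hz
  linear_combination this

theorem IsEigenfunction.continuousOn {mu : ℝ} {phi : ℝ → ℝ} (hphi : P.IsEigenfunction mu phi) :
    ContinuousOn phi (Set.Icc 0 1) := by
  obtain ⟨dphi, ddphi, H, -⟩ := hphi
  exact H.toIsH2.continuousOn

theorem IsEigenfunction.integral_opA_mul {mu : ℝ} {phi : ℝ → ℝ} (hphi : P.IsEigenfunction mu phi)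
    (H : P.InDomain h dh ddh) :
    ∫ z, P.opA h ddh z * phi z ∂unitVol = mu * ∫ z, h z * phi z ∂unitVol := by
  obtain ⟨dphi, ddphi, H', he, -⟩ := hphi
  rw [integral_opA_symm H H', ← integral_const_mul]
  refine integral_congr_ae ?_
  filter_upwards [he] with z hz
  rw [hz]; ring

theorem IsEigenfunction.integral_mul_eq_zero {mu nu : ℝ} {phi psi : ℝ → ℝ}
    (hphi : P.IsEigenfunction mu phi) (hpsi : P.IsEigenfunction nu psi) (hne : mu ≠ nu) :
    ∫ z, phi z * psi z ∂unitVol = 0 := by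
  have h2 := hpsi
  obtain ⟨dphi, ddphi, H, he, -⟩ := hphi
  have h1 := h2.integral_opA_mul H
  have h3 : ∫ z, P.opA phi ddphi z * psi z ∂unitVol = mu * ∫ z, phi z * psi z ∂unitVol := by
    rw [← integral_const_mul]
    refine integral_congr_ae ?_
    filter_upwards [he] with z hz
    rw [hz]; ring
  have : (mu - nu) * ∫ z, phi z * psi z ∂unitVol = 0 := by linear_combination h1 - h3
  exact (mul_eq_zero.1 this).resolve_left (sub_ne_zero.2 hne)

/-- Polynomials with `g 0 = g 1 = 0` and `(g' 0, g' 1)` a unit vector. -/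
def lift : Fin 2 → ℝ → ℝ := ![fun z => z * (1 - z) ^ 2, fun z => z ^ 2 * (z - 1)]

def liftDeriv : Fin 2 → ℝ → ℝ := ![fun z => 3 * z ^ 2 - 4 * z + 1, fun z => 3 * z ^ 2 - 2 * z]

def liftDeriv2 : Fin 2 → ℝ → ℝ := ![fun z => 6 * z - 4, fun z => 6 * z - 2]

theorem isH2_lift (k : Fin 2) : IsH2 (lift k) (liftDeriv k) (liftDeriv2 k) := by
  have key : ∀ F f : ℝ → ℝ, (∀ z, HasDerivAt F (f z) z) → Continuous f →
      ∀ z ∈ Set.Icc (0 : ℝ) 1, F z = F 0 + ∫ s in (0 : ℝ)..z, f s := by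
    intro F f hF hf z _
    rw [intervalIntegral.integral_eq_sub_of_hasDerivAt (fun x _ => hF x)
      (hf.intervalIntegrable _ _)]
    ring
  have hid : ∀ z : ℝ, HasDerivAt (fun z : ℝ => z) 1 z := hasDerivAt_id
  have hp : ∀ (n : ℕ) (z : ℝ), HasDerivAt (fun z : ℝ => z ^ n) (n * z ^ (n - 1)) z :=
    hasDerivAt_pow
  have hc1 : ∀ k, Continuous (liftDeriv k) := by
    intro k; fin_cases k <;> simp [liftDeriv] <;> fun_prop
  have hc2 : ∀ k, Continuous (liftDeriv2 k) := by
    intro k; fin_cases k <;> simp [liftDeriv2] <;> fun_prop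
  fin_cases k
  · refine ⟨(hc2 _).continuousOn.memLp_unitVol, key _ _ (fun z => ?_)
      (hc1 _), key _ _ (fun z => ?_)
      (hc2 _)⟩
    · have := (hid z).mul (((hasDerivAt_const z (1 : ℝ)).sub (hid z)).pow 2)
      convert! this using 1
      simp [liftDeriv]; ring
    · have := (((hp 2 z).const_mul 3).sub ((hid z).const_mul 4)).add_const 1
      convert! this using 1
      simp [liftDeriv2]; ring
  · refine ⟨(hc2 _).continuousOn.memLp_unitVol, key _ _ (fun z => ?_)
      (hc1 _), key _ _ (fun z => ?_)
      (hc2 _)⟩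
    · have := (hp 2 z).mul ((hid z).sub_const 1)
      convert! this using 1
      simp [liftDeriv]; ring
    · have := ((hp 2 z).const_mul 3).sub ((hid z).const_mul 2)
      convert! this using 1
      simp [liftDeriv2]; ring

/-- The input vector of an element of the domain, expressed by bounded functionals of `h`
and `𝒜 h`. -/
theorem inputVec_eq (H : P.InDomain h dh ddh) (k : Fin 2) :
    inputVec P.rho h k = ∫ z, P.opA (lift k) (liftDeriv2 k) z * h z ∂unitVol
      - ∫ z, lift k z * P.opA h ddh z ∂unitVol := by
  -- The lift vanishes at both ends with slope 1 at exactly one of them, so a single boundary value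
  -- of `h` survives in Green's identity.
  rw [P.integral_opA_sub (isH2_lift k) H.toIsH2]
  fin_cases k
  · simp [inputVec, lift, liftDeriv]; ring
  · simp only [inputVec, lift, liftDeriv, Fin.mk_one, Matrix.cons_val_one, Matrix.cons_val_fin_one]
    ring

end ParabolicPlant

open scoped BoundedContinuousFunction

/-! ### Compactness of operators with a continuous Hilbert-space-valued kernel. -/

section InnerKernel

variable {X : Type*} [TopologicalSpace X] [CompactSpace X] {H : Type*} [NormedAddCommGroup H]
  [InnerProductSpace ℝ H]

/-- The operator `f ↦ (z ↦ ⟪χ z, f⟫)`. -/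
def innerKernel (χ : C(X, H)) : H →L[ℝ] (X →ᵇ ℝ) :=
  LinearMap.mkContinuous
    { toFun := fun f => BoundedContinuousFunction.mkOfCompact
        ⟨fun z => inner ℝ (χ z) f, χ.continuous.inner continuous_const⟩
      map_add' := fun f g => by ext z; simp [inner_add_right]
      map_smul' := fun c f => by ext z; simp [inner_smul_right] } ‖χ‖ (fun f => by
    refine (BoundedContinuousFunction.norm_le (by positivity)).2 fun z => ?_
    exact (norm_inner_le_norm _ _).trans
      (mul_le_mul_of_nonneg_right (χ.norm_coe_le_norm z) (norm_nonneg f)))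

@[simp] theorem innerKernel_apply (χ : C(X, H)) (f : H) (z : X) :
    innerKernel χ f z = inner ℝ (χ z) f := rfl

/-- Arzelà–Ascoli: on the unit ball the images are bounded by ‖χ‖, and by Cauchy–Schwarz they
inherit the modulus of continuity of χ. -/
theorem isCompactOperator_innerKernel (χ : C(X, H)) : IsCompactOperator (innerKernel χ) := by
  rw [← ContinuousLinearMap.coe_coe,
    isCompactOperator_iff_isCompact_closure_image_closedBall _ one_pos]
  refine BoundedContinuousFunction.arzela_ascoli (Metric.closedBall 0 ‖χ‖)
    (isCompact_closedBall _ _) _ ?_ ?_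
  · rintro _ z ⟨f, hf, rfl⟩
    rw [mem_closedBall_zero_iff] at hf ⊢
    calc ‖inner ℝ (χ z) f‖ ≤ ‖χ z‖ * ‖f‖ := norm_inner_le_norm _ _
      _ ≤ ‖χ‖ * 1 := mul_le_mul (χ.norm_coe_le_norm z) hf (norm_nonneg _) (norm_nonneg _)
      _ = ‖χ‖ := mul_one _
  · intro z₀
    rw [Metric.equicontinuousAt_iff_right]
    intro ε hε
    have : ∀ᶠ z in nhds z₀, dist (χ z₀) (χ z) < ε := by
      have := (χ.continuous.tendsto z₀).eventually (Metric.ball_mem_nhds _ hε)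
      filter_upwards [this] with z hz
      rw [dist_comm]; exact hz
    filter_upwards [this] with z hz
    rintro ⟨_, f, hf, rfl⟩
    rw [mem_closedBall_zero_iff] at hf
    refine lt_of_le_of_lt ?_ hz
    change dist (inner ℝ (χ z₀) f) (inner ℝ (χ z) f) ≤ _
    rw [dist_eq_norm, dist_eq_norm, ← inner_sub_left]
    calc _ ≤ ‖χ z₀ - χ z‖ * ‖f‖ := norm_inner_le_norm _ _
      _ ≤ ‖χ z₀ - χ z‖ * 1 := by gcongr
      _ = _ := mul_one _

end InnerKernel

/-! ### The Volterra operator on L²(0,1). -/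

/-- The closed unit interval. -/
abbrev UnitIcc : Type := Set.Icc (0 : ℝ) 1

/-- Real-valued square integrable functions on `(0,1)`. -/
abbrev RealL2 : Type := Lp ℝ 2 unitVol

/-- The indicator of `(0, z)` as an element of `L²(0,1)`. -/
def indicatorBelow (z : ℝ) : RealL2 :=
  indicatorConstLp 2 (measurableSet_Iic (a := z)) (measure_ne_top _ _) 1

theorem inner_indicatorBelow (z : UnitIcc) (f : RealL2) :
    inner ℝ (indicatorBelow z) f = ∫ s in (0 : ℝ)..z, f s := by
  rw [indicatorBelow, L2.inner_indicatorConstLp_one, intervalIntegral.integral_of_le z.2.1,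
    integral_Ioc_eq_integral_Ioo, Measure.restrict_restrict measurableSet_Iic,
    ← integral_Ioc_eq_integral_Ioo]
  refine setIntegral_congr_set ?_
  have : Set.Ioc (0 : ℝ) z = Set.Iic (z : ℝ) ∩ Set.Ioc 0 1 := by
    ext s; simp only [Set.mem_Ioc, Set.mem_inter_iff, Set.mem_Iic]
    exact ⟨fun h => ⟨h.2, h.1, h.2.trans z.2.2⟩, fun h => ⟨h.2.1, h.1⟩⟩
  rw [this]
  exact ae_eq_set_inter (Filter.EventuallyEq.refl _ _) Ioo_ae_eq_Ioc

/-- Inner products of the indicators are minima of their endpoints. The resulting 1/2-Hölder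
dependence on the endpoint makes the Volterra kernel continuous in L², hence the Volterra operator
compact. -/
theorem dist_indicatorBelow_sq (z w : UnitIcc) :
    ‖indicatorBelow z - indicatorBelow w‖ ^ 2 = |(z : ℝ) - w| := by
  have key : ∀ z w : UnitIcc, inner ℝ (indicatorBelow z) (indicatorBelow w) = min (z : ℝ) w := by
    intro z w
    rw [indicatorBelow, indicatorBelow, L2.real_inner_indicatorConstLp_one_indicatorConstLp_one,
      Set.Iic_inter_Iic, measureReal_restrict_apply measurableSet_Iic]
    have : (Set.Iic (min (z : ℝ) w) ∩ Set.Ioo 0 1 : Set ℝ) =ᵐ[volume]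
        Set.Ioc (0 : ℝ) (min (z : ℝ) w) := by
      have h : Set.Ioc (0 : ℝ) (min (z : ℝ) w) = Set.Iic (min (z : ℝ) w) ∩ Set.Ioc 0 1 := by
        ext s; simp only [Set.mem_Ioc, Set.mem_inter_iff, Set.mem_Iic]
        exact ⟨fun h => ⟨h.2, h.1, h.2.trans ((min_le_left _ _).trans z.2.2)⟩,
          fun h => ⟨h.2.1, h.1⟩⟩
      rw [h]
      exact ae_eq_set_inter (Filter.EventuallyEq.refl _ _) Ioo_ae_eq_Ioc
    rw [measureReal_congr this, Real.volume_real_Ioc_of_le (le_min z.2.1 w.2.1), sub_zero]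
  rw [norm_sub_sq_real, ← real_inner_self_eq_norm_sq, ← real_inner_self_eq_norm_sq, key, key, key,
    min_self, min_self]
  rcases le_total (z : ℝ) w with h | h
  · rw [min_eq_left h, abs_of_nonpos (by linarith)]; ring
  · rw [min_eq_right h, abs_of_nonneg (by linarith)]; ring

def indicatorBelowMap : C(UnitIcc, RealL2) :=
  ⟨fun z => indicatorBelow z, by
    rw [continuous_iff_continuousAt]
    intro w
    rw [ContinuousAt, tendsto_iff_norm_sub_tendsto_zero]
    have h : ∀ z : UnitIcc, ‖indicatorBelow z - indicatorBelow w‖ = Real.sqrt |(z : ℝ) - w| := by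
      intro z
      rw [← dist_indicatorBelow_sq, Real.sqrt_sq (norm_nonneg _)]
    simp_rw [h]
    have : Continuous fun z : UnitIcc => Real.sqrt |(z : ℝ) - w| := by fun_prop
    simpa using this.tendsto w⟩

/-- The Volterra operator `f ↦ ∫₀ᶻ f`. -/
def volterra : RealL2 →L[ℝ] (UnitIcc →ᵇ ℝ) := innerKernel indicatorBelowMap

theorem volterra_apply (f : RealL2) (z : UnitIcc) : volterra f z = ∫ s in (0 : ℝ)..z, f s :=
  inner_indicatorBelow z f

theorem isCompactOperator_volterra : IsCompactOperator volterra :=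
  isCompactOperator_innerKernel _

/-- The projection of the real line to `[0,1]`. -/
def projUnit : C(ℝ, UnitIcc) := ⟨Set.projIcc 0 1 zero_le_one, continuous_projIcc⟩

theorem projUnit_of_mem {z : ℝ} (hz : z ∈ Set.Icc (0 : ℝ) 1) : projUnit z = ⟨z, hz⟩ :=
  Set.projIcc_of_mem zero_le_one hz

/-- The embedding of `C[0,1]` into `L²(0,1)`. -/
def toRealL2 : (UnitIcc →ᵇ ℝ) →L[ℝ] RealL2 :=
  (BoundedContinuousFunction.toLp 2 unitVol ℝ).comp
    (BoundedContinuousFunction.compContinuousCLM (β := ℝ) ℝ projUnit)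

theorem coeFn_toRealL2 (f : UnitIcc →ᵇ ℝ) : toRealL2 f =ᵐ[unitVol] fun z => f (projUnit z) :=
  BoundedContinuousFunction.coeFn_toLp 2 unitVol ℝ _

theorem eq_zero_of_ae_zero {f : UnitIcc →ᵇ ℝ} (hf : (fun z => f (projUnit z)) =ᵐ[unitVol] 0) :
    f = 0 := by
  have h : Set.EqOn (fun z => f (projUnit z)) 0 (Set.Icc 0 1) := by
    have h1 := Measure.eqOn_of_ae_eq (μ := volume) (s := Set.Ioo (0 : ℝ) 1) hf
      (f.continuous.comp projUnit.continuous).continuousOn continuousOn_const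
      (by rw [interior_Ioo]; exact subset_closure)
    have h2 := h1.closure (f.continuous.comp projUnit.continuous) continuous_const
    rwa [closure_Ioo (by norm_num)] at h2
  ext z
  have := h z.2
  simpa [projUnit_of_mem z.2] using this

/-! ### The resolvent of 𝒜 by shooting and the Fredholm alternative. -/

namespace ParabolicPlant

variable (P : ParabolicPlant) (mu : ℝ)

/-- The potential `(a - μ) / ρ` on `[0,1]`. -/
def potential : UnitIcc →ᵇ ℝ :=
  BoundedContinuousFunction.mkOfCompact
    ⟨fun z => (P.a z - mu) / P.rho, (P.a_cont.domRestrict.sub continuous_const).div_const _⟩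

theorem potential_projUnit {z : ℝ} (hz : z ∈ Set.Icc (0 : ℝ) 1) :
    P.potential mu (projUnit z) = (P.a z - mu) / P.rho := by
  rw [projUnit_of_mem hz]; rfl

/-- The derivative of the function with second derivative `w` and initial value `c` satisfying
the boundary condition at `0`. -/
def shootDeriv : RealL2 × ℝ →L[ℝ] (UnitIcc →ᵇ ℝ) :=
  (ContinuousLinearMap.snd ℝ RealL2 ℝ).smulRight (BoundedContinuousFunction.const UnitIcc P.q0)
    + volterra.comp (ContinuousLinearMap.fst ℝ RealL2 ℝ)

/-- The function with second derivative `w` and initial value `c` satisfying the boundary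
condition at `0`. -/
def shoot : RealL2 × ℝ →L[ℝ] (UnitIcc →ᵇ ℝ) :=
  (ContinuousLinearMap.snd ℝ RealL2 ℝ).smulRight (BoundedContinuousFunction.const UnitIcc 1)
    + volterra.comp (toRealL2.comp P.shootDeriv)

theorem shootDeriv_apply (p : RealL2 × ℝ) (z : UnitIcc) :
    P.shootDeriv p z = p.2 * P.q0 + ∫ s in (0 : ℝ)..z, p.1 s := by
  rw [← volterra_apply]; rfl

theorem shoot_apply (p : RealL2 × ℝ) (z : UnitIcc) :
    P.shoot p z = p.2 + ∫ s in (0 : ℝ)..z, P.shootDeriv p (projUnit s) := by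
  rw [← intervalIntegral_congr_unitVol (coeFn_toRealL2 (P.shootDeriv p)) z.2, ← volterra_apply]
  simp [shoot]

theorem isCompactOperator_snd_smulRight (f : UnitIcc →ᵇ ℝ) :
    IsCompactOperator ((ContinuousLinearMap.snd ℝ RealL2 ℝ).smulRight f) :=
  (isCompactOperator_of_locallyCompactSpace_dom
    (ContinuousLinearMap.snd ℝ RealL2 ℝ)).clm_comp
      ((ContinuousLinearMap.id ℝ ℝ).smulRight f)

theorem isCompactOperator_shoot : IsCompactOperator P.shoot :=
  (isCompactOperator_snd_smulRight _).add
    (isCompactOperator_volterra.comp_clm (toRealL2.comp P.shootDeriv))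

theorem isH2_shoot (p : RealL2 × ℝ) :
    IsH2 (fun z => P.shoot p (projUnit z)) (fun z => P.shootDeriv p (projUnit z)) p.1 := by
  refine ⟨Lp.memLp p.1, fun z hz => ?_, fun z hz => ?_⟩
  · simp only [projUnit_of_mem hz, projUnit_of_mem (Set.left_mem_Icc.2 zero_le_one), shoot_apply]
    simp
  · simp only [projUnit_of_mem hz, projUnit_of_mem (Set.left_mem_Icc.2 zero_le_one),
      shootDeriv_apply]
    simp

/-- The boundary value problem `(𝒜 - μ) h = ρ f` in terms of `h''` and `h 0`, as a compact
perturbation of the identity. -/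
def shootPerturb : RealL2 × ℝ →L[ℝ] RealL2 × ℝ :=
  (ContinuousLinearMap.inl ℝ RealL2 ℝ).comp
      ((toRealL2.comp (ContinuousLinearMap.mul ℝ (UnitIcc →ᵇ ℝ) (P.potential mu))).comp P.shoot)
    -- Subtracting the second projection cancels the identity in that component, so the second
    -- component of `p + P.shootPerturb mu p` is exactly the defect in the boundary condition at 1.
    + (ContinuousLinearMap.inr ℝ RealL2 ℝ).comp
      ((BoundedContinuousFunction.evalCLM ℝ (1 : UnitIcc)).comp (P.shootDeriv - P.q1 • P.shoot)
        - ContinuousLinearMap.snd ℝ RealL2 ℝ)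

theorem isCompactOperator_shootPerturb : IsCompactOperator (P.shootPerturb mu) := by
  refine IsCompactOperator.add ?_ ?_
  · exact (P.isCompactOperator_shoot.clm_comp
      (toRealL2.comp (ContinuousLinearMap.mul ℝ (UnitIcc →ᵇ ℝ) (P.potential mu)))).clm_comp
        (ContinuousLinearMap.inl ℝ RealL2 ℝ)
  · exact (isCompactOperator_of_locallyCompactSpace_dom
      ((BoundedContinuousFunction.evalCLM ℝ (1 : UnitIcc)).comp (P.shootDeriv - P.q1 • P.shoot)
        - ContinuousLinearMap.snd ℝ RealL2 ℝ)).clm_comp (ContinuousLinearMap.inr ℝ RealL2 ℝ)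

/-- If `p` solves the shooting equation with right-hand side `f`, then `shoot p` is in the domain
and `(𝒜 - μ) (shoot p) = ρ f`. -/
theorem inDomain_shoot {p : RealL2 × ℝ} {f : RealL2} (hp : p + P.shootPerturb mu p = (f, 0)) :
    P.InDomain (fun z => P.shoot p (projUnit z)) (fun z => P.shootDeriv p (projUnit z)) p.1 ∧
      ∀ᵐ z ∂unitVol, P.opA (fun z => P.shoot p (projUnit z)) p.1 z
        = mu * P.shoot p (projUnit z) + P.rho * f z := by
  have hp1 : p.1 + toRealL2 (P.potential mu * P.shoot p) = f := by
    simpa [shootPerturb] using congrArg Prod.fst hp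
  have hp2 : P.shootDeriv p 1 - P.q1 * P.shoot p 1 = 0 := by
    simpa [shootPerturb] using congrArg Prod.snd hp
  refine ⟨⟨P.isH2_shoot p, ?_, ?_⟩, ?_⟩
  · simp only [projUnit_of_mem (Set.left_mem_Icc.2 zero_le_one), shoot_apply, shootDeriv_apply]
    simp; ring
  · simp only [projUnit_of_mem (Set.right_mem_Icc.2 zero_le_one)]
    exact sub_eq_zero.1 hp2
  · have h1 := Lp.coeFn_add p.1 (toRealL2 (P.potential mu * P.shoot p))
    rw [hp1] at h1
    filter_upwards [h1, coeFn_toRealL2 (P.potential mu * P.shoot p),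
      ae_restrict_mem measurableSet_Ioo] with z h1 h2 hz
    have hρ := P.rho_pos.ne'
    rw [h1, Pi.add_apply, h2, BoundedContinuousFunction.mul_apply,
      P.potential_projUnit mu (Set.Ioo_subset_Icc_self hz), opA]
    field_simp
    ring

variable {mu}

/-- Fredholm alternative at the value -1: an eigenvector there would solve the homogeneous boundary
value problem, so it would produce an eigenfunction of 𝒜 for μ unless the shot function vanishes, in
which case the unknowns h'' and h(0) vanish too. -/
theorem isUnit_one_add_shootPerturb (hmu : ∀ phi, ¬ P.IsEigenfunction mu phi) :
    IsUnit (1 + P.shootPerturb mu) := by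
  rcases (P.isCompactOperator_shootPerturb mu).hasEigenvalue_or_mem_resolventSet
    (μ := (-1 : ℝ)) (by norm_num) with h | h
  · exfalso
    obtain ⟨p, hp⟩ := h.exists_hasEigenvector
    have hp0 := hp.2
    have hp1 : P.shootPerturb mu p = -p := by simpa using hp.apply_eq_smul
    have hp2 : p + P.shootPerturb mu p = ((0 : RealL2), (0 : ℝ)) := by
      rw [hp1]; simp; rfl
    obtain ⟨hD, he⟩ := P.inDomain_shoot mu hp2
    have hzero : P.shoot p = 0 := by
      by_contra hne
      obtain ⟨z, hz⟩ : ∃ z, P.shoot p z ≠ 0 := by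
        by_contra hall
        push Not at hall
        exact hne (by ext z; exact hall z)
      refine hmu _ ⟨_, _, hD, ?_, z, z.2, by simpa [projUnit_of_mem z.2] using hz⟩
      filter_upwards [he, Lp.coeFn_zero ℝ 2 unitVol] with z h1 h2
      rw [h1, h2]; simp
    apply hp0
    have h1 : p.1 + toRealL2 (P.potential mu * P.shoot p) = 0 := by
      simpa [shootPerturb] using congrArg Prod.fst hp2
    have h2 : p.2 = 0 := by
      have := P.shoot_apply p 0
      rw [hzero] at this
      simpa using this.symm
    rw [hzero, mul_zero, map_zero, add_zero] at h1
    exact Prod.ext h1 h2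
  · rw [spectrum.mem_resolventSet_iff] at h
    have := h.neg
    convert! this using 1
    simp [add_comm]

/-- For `μ` not an eigenvalue, `𝒜 - μ` has a compact inverse on `L²(0,1)`. -/
theorem exists_resolvent (hmu : ∀ phi, ¬ P.IsEigenfunction mu phi) :
    ∃ G : RealL2 →L[ℝ] RealL2, IsCompactOperator G ∧ ∀ f, ∃ (h : UnitIcc →ᵇ ℝ) (dh ddh : ℝ → ℝ),
      P.InDomain (fun z => h (projUnit z)) dh ddh ∧ G f = toRealL2 h ∧
      ∀ᵐ z ∂unitVol, P.opA (fun z => h (projUnit z)) ddh z = mu * h (projUnit z) + f z := by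
  obtain ⟨U, hU⟩ := P.isUnit_one_add_shootPerturb hmu
  set S : RealL2 × ℝ →L[ℝ] RealL2 × ℝ := ↑U⁻¹ with hS
  have hUS : ∀ p, S p + P.shootPerturb mu (S p) = p := by
    intro p
    have h1 : (1 + P.shootPerturb mu) * S = 1 := by rw [← hU]; exact U.mul_inv
    simpa using congrArg (fun T : RealL2 × ℝ →L[ℝ] RealL2 × ℝ => T p) h1
  -- Shooting with data f solves (𝒜 - μ)h = ρ f, which the factor `P.rho⁻¹` compensates.
  refine ⟨(toRealL2.comp P.shoot).comp
    (S.comp (P.rho⁻¹ • ContinuousLinearMap.inl ℝ RealL2 ℝ)), ?_, fun f => ?_⟩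
  · exact (P.isCompactOperator_shoot.clm_comp toRealL2).comp_clm _
  · set p := S (P.rho⁻¹ • f, 0) with hp
    have hp2 : p + P.shootPerturb mu p = (P.rho⁻¹ • f, 0) := hUS _
    obtain ⟨hD, he⟩ := P.inDomain_shoot mu hp2
    refine ⟨P.shoot p, _, _, hD, ?_, ?_⟩
    · rw [hp]; simp only [ContinuousLinearMap.comp_apply, _root_.smul_apply,
        ContinuousLinearMap.inl_apply, Prod.smul_mk, smul_zero]
    · filter_upwards [he, Lp.coeFn_smul P.rho⁻¹ f] with z h1 h2
      rw [h1, h2, Pi.smul_apply, smul_eq_mul, mul_inv_cancel_left₀ P.rho_pos.ne']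

end ParabolicPlant

/-! ### Completeness of the eigenfunctions. -/

theorem ae_eq_zero_of_primitive_eq_zero {F f : ℝ → ℝ} (hf : IntervalIntegrable f volume 0 1)
    (hF : ∀ z ∈ Set.Icc (0 : ℝ) 1, F z = F 0 + ∫ s in (0 : ℝ)..z, f s)
    (h0 : ∀ z ∈ Set.Icc (0 : ℝ) 1, F z = 0) : f =ᵐ[unitVol] 0 := by
  rw [Filter.EventuallyEq, ae_restrict_iff' measurableSet_Ioo]
  filter_upwards [hf.ae_hasDerivAt_integral] with z hz hzI
  have h1 := hz (by rw [uIcc_zero_one]; exact Set.Ioo_subset_Icc_self hzI) 0 (by simp)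
  have h2 : HasDerivAt (fun x => ∫ t in (0 : ℝ)..x, f t) 0 z := by
    refine (hasDerivAt_const z (0 : ℝ)).congr_of_eventuallyEq ?_
    filter_upwards [Ioo_mem_nhds hzI.1 hzI.2] with y hy
    have hy' := Set.Ioo_subset_Icc_self hy
    have := hF y hy'
    rw [h0 y hy', h0 0 (by simp)] at this
    linarith
  exact h1.unique h2

/-- Used for injectivity of the resolvent: if its output h vanishes, so does h'', and the
differential equation makes the input vanish. -/
theorem IsH2.ddh_ae_eq_zero {h dh ddh : ℝ → ℝ} (H : IsH2 h dh ddh)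
    (h0 : ∀ z ∈ Set.Icc (0 : ℝ) 1, h z = 0) : ddh =ᵐ[unitVol] 0 := by
  have h1 := ae_eq_zero_of_primitive_eq_zero H.intervalIntegrable_dh H.eq_integral h0
  have h2 : Set.EqOn dh 0 (Set.Ioo 0 1) :=
    Measure.eqOn_of_ae_eq (μ := volume) h1 (H.continuousOn_dh.mono Set.Ioo_subset_Icc_self)
      continuousOn_const (by rw [interior_Ioo]; exact subset_closure)
  have h3 : Set.EqOn dh 0 (Set.Icc 0 1) :=
    h2.of_subset_closure H.continuousOn_dh continuousOn_const Set.Ioo_subset_Icc_self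
      (by rw [closure_Ioo (by norm_num)])
  exact ae_eq_zero_of_primitive_eq_zero H.intervalIntegrable_ddh H.deriv_eq_integral h3

theorem realL2_inner (f g : RealL2) : inner ℝ f g = ∫ z, f z * g z ∂unitVol := by
  rw [L2.inner_def]
  congr 1 with z
  simp [mul_comm]

theorem integrable_mul_of_memLp {f g : ℝ → ℝ} (hf : MemLp f 2 unitVol) (hg : MemLp g 2 unitVol) :
    Integrable (fun z => f z * g z) unitVol :=
  hf.integrable_mul hg

namespace ParabolicPlant

variable {P : ParabolicPlant}

/-- The eigenfunctions of `𝒜` are complete in the real space `L²(0,1)`. -/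
theorem IsEigensystem.eq_zero_of_forall_integral {lam : ℕ → ℝ} {phi : ℕ → ℝ → ℝ}
    (hsys : P.IsEigensystem lam phi) {f : RealL2}
    (hf : ∀ i, ∫ z, f z * phi i z ∂unitVol = 0) : f = 0 := by
  -- A point above the largest eigenvalue, hence not an eigenvalue.
  set mu := lam 0 + 1 with hmu_def
  have hmu : ∀ psi, ¬ P.IsEigenfunction mu psi := by
    intro psi hpsi
    obtain ⟨i, hi⟩ := hsys.exhaustive mu psi hpsi
    have := hsys.strictAnti.antitone (Nat.zero_le i)
    linarith
  obtain ⟨G, hG, hGf⟩ := P.exists_resolvent hmu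
  have hsymm : G.IsSymmetric := by
    intro f g
    obtain ⟨h, dh, ddh, hD, hh, he⟩ := hGf f
    obtain ⟨k, dk, ddk, kD, hk, ke⟩ := hGf g
    change inner ℝ (G f) g = inner ℝ f (G g)
    rw [hh, hk, realL2_inner, realL2_inner]
    have mh := hD.toIsH2.continuousOn.memLp_unitVol
    have mk := kD.toIsH2.continuousOn.memLp_unitVol
    have e1 : ∫ z, toRealL2 h z * g z ∂unitVol =
        ∫ z, h (projUnit z) * P.opA (fun z => k (projUnit z)) ddk z ∂unitVol
          - ∫ z, mu * (h (projUnit z) * k (projUnit z)) ∂unitVol := by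
      rw [← integral_sub (integrable_mul_of_memLp mh (P.memLp_opA kD.toIsH2))
        ((integrable_mul_of_memLp mh mk).const_mul mu)]
      refine integral_congr_ae ?_
      filter_upwards [coeFn_toRealL2 h, ke] with z h1 h2
      rw [h1, h2]; ring
    have e2 : ∫ z, f z * toRealL2 k z ∂unitVol =
        ∫ z, P.opA (fun z => h (projUnit z)) ddh z * k (projUnit z) ∂unitVol
          - ∫ z, mu * (h (projUnit z) * k (projUnit z)) ∂unitVol := by
      rw [← integral_sub (integrable_mul_of_memLp (P.memLp_opA hD.toIsH2) mk)
        ((integrable_mul_of_memLp mh mk).const_mul mu)]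
      refine integral_congr_ae ?_
      filter_upwards [coeFn_toRealL2 k, he] with z h1 h2
      rw [h1, h2]; ring
    rw [e1, e2, integral_opA_symm hD kD]
  have hinj : ∀ v, G v = 0 → v = 0 := by
    intro v hv
    obtain ⟨h, dh, ddh, hD, hh, he⟩ := hGf v
    have h0 : h = 0 := by
      refine eq_zero_of_ae_zero ?_
      have h1 := coeFn_toRealL2 h
      rw [← hh, hv] at h1
      exact h1.symm.trans (Lp.coeFn_zero ℝ 2 unitVol)
    have hdd := hD.toIsH2.ddh_ae_eq_zero (by simp [h0])
    rw [Lp.eq_zero_iff_ae_eq_zero]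
    filter_upwards [hdd, he] with z h1 h2
    simp [opA, h0, h1] at h2
    exact h2.symm
  have hbot := ContinuousLinearMap.orthogonalComplement_iSup_eigenspaces_eq_bot hG hsymm
  -- By the spectral theorem it suffices that `f` is orthogonal to every eigenvector of the
  -- resolvent.
  rw [← Submodule.mem_bot ℝ, ← hbot, ← Submodule.iInf_orthogonal, Submodule.mem_iInf]
  intro nu
  rw [Submodule.mem_orthogonal]
  intro v hv
  have hv : G v = nu • v := by simpa [Module.End.mem_eigenspace_iff] using hv
  rcases eq_or_ne v 0 with rfl | hv0
  · simp
  have hnu : nu ≠ 0 := by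
    rintro rfl
    exact hv0 (hinj v (by rw [hv, zero_smul]))
  obtain ⟨h, dh, ddh, hD, hh, he⟩ := hGf v
  have hvh : v = nu⁻¹ • toRealL2 h := by rw [← hh, hv, inv_smul_smul₀ hnu]
  have hv_ae : v =ᵐ[unitVol] fun z => nu⁻¹ * h (projUnit z) := by
    have h1 := Lp.coeFn_smul nu⁻¹ (toRealL2 h)
    rw [← hvh] at h1
    filter_upwards [h1, coeFn_toRealL2 h] with z h1 h2
    rw [h1, Pi.smul_apply, h2, smul_eq_mul]
  -- From G v = ν v, the representative h of G v satisfies (𝒜 - μ)h = v = ν⁻¹ h.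
  have heig : P.IsEigenfunction (mu + nu⁻¹) (fun z => h (projUnit z)) := by
    refine ⟨dh, ddh, hD, ?_, ?_⟩
    · filter_upwards [he, hv_ae] with z h1 h2
      rw [h1, h2]; ring
    · by_contra hall
      push Not at hall
      apply hv0
      rw [hvh]
      have : h = 0 := by
        ext z
        simpa [projUnit_of_mem z.2] using hall z z.2
      rw [this, map_zero, smul_zero]
  obtain ⟨i, hi⟩ := hsys.exhaustive _ _ heig
  obtain ⟨c, hc⟩ := (hi ▸ hsys.eigenfunction i).exists_eq_mul heig
  rw [realL2_inner]
  have : ∫ z, v z * f z ∂unitVol = ∫ z, (nu⁻¹ * c) * (f z * phi i z) ∂unitVol := by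
    refine integral_congr_ae ?_
    filter_upwards [hv_ae, ae_restrict_mem measurableSet_Ioo] with z h1 hz
    rw [h1, hc z (Set.Ioo_subset_Icc_self hz)]; ring
  rw [this, integral_const_mul, hf i, mul_zero]

end ParabolicPlant

/-! ### The orthonormal eigenbasis of the complex state space. -/

/-- A real-valued square integrable function as an element of the state space. -/
def complexify {psi : ℝ → ℝ} (h : MemLp psi 2 unitVol) : StateSpace :=
  MemLp.toLp (fun z => (psi z : ℂ)) h.ofReal

theorem coeFn_complexify {psi : ℝ → ℝ} (h : MemLp psi 2 unitVol) :
    complexify h =ᵐ[unitVol] fun z => (psi z : ℂ) :=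
  MemLp.coeFn_toLp _

theorem functional_eq_inner {psi : ℝ → ℝ} (h : MemLp psi 2 unitVol) (x : StateSpace) :
    functional psi x = inner ℂ (complexify h) x := by
  rw [L2.inner_def, functional]
  refine integral_congr_ae ?_
  filter_upwards [coeFn_complexify h] with z hz
  rw [hz]
  simp

theorem inner_complexify {psi chi : ℝ → ℝ} (h : MemLp psi 2 unitVol) (h' : MemLp chi 2 unitVol) :
    inner ℂ (complexify h) (complexify h') = ((∫ z, psi z * chi z ∂unitVol : ℝ) : ℂ) := by
  rw [← functional_eq_inner, functional, ← integral_complex_ofReal]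
  refine integral_congr_ae ?_
  filter_upwards [coeFn_complexify h'] with z hz
  rw [hz]; push_cast; ring

theorem integrable_mul_ofReal (x : StateSpace) {psi : ℝ → ℝ} (h : MemLp psi 2 unitVol) :
    Integrable (fun z => x z * (psi z : ℂ)) unitVol :=
  (Lp.memLp x).integrable_mul h.ofReal

namespace ParabolicPlant

variable {P : ParabolicPlant} {lam : ℕ → ℝ} {phi : ℕ → ℝ → ℝ}

theorem IsEigensystem.memLp (hsys : P.IsEigensystem lam phi) (i : ℕ) : MemLp (phi i) 2 unitVol :=
  (hsys.eigenfunction i).continuousOn.memLp_unitVol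

theorem IsEigensystem.orthonormal (hsys : P.IsEigensystem lam phi) :
    Orthonormal ℂ fun i => complexify (hsys.memLp i) := by
  rw [orthonormal_iff_ite]
  intro i j
  rw [inner_complexify]
  split_ifs with hij
  · subst hij
    have := hsys.normalized i
    simp_rw [sq] at this
    rw [this, Complex.ofReal_one]
  · rw [(hsys.eigenfunction i).integral_mul_eq_zero (hsys.eigenfunction j)
      (hsys.strictAnti.injective.ne hij), Complex.ofReal_zero]

/-- The eigenfunctions of `𝒜` are complete in `L²(0,1)`. -/
theorem IsEigensystem.orthogonal_span_eq_bot (hsys : P.IsEigensystem lam phi) :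
    (Submodule.span ℂ (Set.range fun i => complexify (hsys.memLp i)))ᗮ = ⊥ := by
  rw [Submodule.eq_bot_iff]
  intro x hx
  have hx' : ∀ i, functional (phi i) x = 0 := fun i => by
    rw [functional_eq_inner (hsys.memLp i)]
    exact (Submodule.mem_orthogonal _ _).1 hx _ (Submodule.subset_span ⟨i, rfl⟩)
  -- The eigenfunctions are real, so real and imaginary parts of `x` are separately orthogonal to
  -- them and the real completeness result applies to each.
  have hre : (Lp.memLp x).re.toLp = 0 := by
    refine hsys.eq_zero_of_forall_integral fun i => ?_
    have h := integral_re (𝕜 := ℂ) (integrable_mul_ofReal x (hsys.memLp i))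
    have h0 : ∫ z, x z * (phi i z : ℂ) ∂unitVol = 0 := hx' i
    rw [h0, map_zero] at h
    refine Eq.trans (integral_congr_ae ?_) h
    filter_upwards [(Lp.memLp x).re.coeFn_toLp] with z hz
    rw [hz]; simp
  have him : (Lp.memLp x).im.toLp = 0 := by
    refine hsys.eq_zero_of_forall_integral fun i => ?_
    have h := integral_im (𝕜 := ℂ) (integrable_mul_ofReal x (hsys.memLp i))
    have h0 : ∫ z, x z * (phi i z : ℂ) ∂unitVol = 0 := hx' i
    rw [h0, map_zero] at h
    refine Eq.trans (integral_congr_ae ?_) h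
    filter_upwards [(Lp.memLp x).im.coeFn_toLp] with z hz
    rw [hz]; simp
  rw [Lp.eq_zero_iff_ae_eq_zero] at hre him ⊢
  filter_upwards [hre, him, (Lp.memLp x).re.coeFn_toLp, (Lp.memLp x).im.coeFn_toLp]
    with z h1 h2 h3 h4
  rw [h3] at h1
  rw [h4] at h2
  exact Complex.ext h1 h2

/-- The orthonormal basis of eigenfunctions. -/
def IsEigensystem.basis (hsys : P.IsEigensystem lam phi) : HilbertBasis ℕ ℂ StateSpace :=
  HilbertBasis.mkOfOrthogonalEqBot hsys.orthonormal hsys.orthogonal_span_eq_bot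

theorem IsEigensystem.basis_apply (hsys : P.IsEigensystem lam phi) (i : ℕ) :
    hsys.basis i = complexify (hsys.memLp i) := by
  rw [IsEigensystem.basis, HilbertBasis.coe_mkOfOrthogonalEqBot]

theorem IsEigensystem.functional_eq (hsys : P.IsEigensystem lam phi) (i : ℕ) (x : StateSpace) :
    functional (phi i) x = inner ℂ (hsys.basis i) x := by
  rw [hsys.basis_apply, functional_eq_inner]

variable {h dh ddh : ℝ → ℝ}

theorem IsEigensystem.inner_opA (hsys : P.IsEigensystem lam phi) (H : P.InDomain h dh ddh) (i : ℕ) :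
    inner ℂ (complexify (P.memLp_opA H.toIsH2)) (hsys.basis i) =
      (lam i : ℂ) * inner ℂ (complexify H.toIsH2.continuousOn.memLp_unitVol) (hsys.basis i) := by
  rw [hsys.basis_apply, inner_complexify, inner_complexify,
    (hsys.eigenfunction i).integral_opA_mul H, Complex.ofReal_mul]

/-- The lifting polynomial as an element of the state space. -/
def liftState (k : Fin 2) : StateSpace := complexify (isH2_lift k).continuousOn.memLp_unitVol

/-- The image of the lifting polynomial under `𝒜`. -/
def opLiftState (P : ParabolicPlant) (k : Fin 2) : StateSpace :=
  complexify (P.memLp_opA (isH2_lift k))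

theorem inputVec_eq_inner (H : P.InDomain h dh ddh) (k : Fin 2) :
    (inputVec P.rho h k : ℂ) =
      inner ℂ (complexify H.toIsH2.continuousOn.memLp_unitVol) (P.opLiftState k)
        - inner ℂ (complexify (P.memLp_opA H.toIsH2)) (liftState k) := by
  rw [opLiftState, liftState, inner_complexify, inner_complexify, inputVec_eq H, Complex.ofReal_sub]
  simp_rw [mul_comm]

/-- Replaces point evaluations of φ_i by Fourier coefficients of fixed L² elements, at the price of
one factor λ_i. This is what tames the boundary inputs. -/
theorem IsEigensystem.inputVec_eq_inner (hsys : P.IsEigensystem lam phi) (i : ℕ) (k : Fin 2) :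
    (inputVec P.rho (phi i) k : ℂ) =
      inner ℂ (hsys.basis i) (P.opLiftState k) - (lam i : ℂ) * inner ℂ (hsys.basis i) (liftState k) := by
  obtain ⟨d, dd, H, he, -⟩ := hsys.eigenfunction i
  have h1 : complexify (P.memLp_opA H.toIsH2) = (lam i : ℂ) • hsys.basis i := by
    rw [hsys.basis_apply]
    refine Lp.ext ?_
    filter_upwards [coeFn_complexify (P.memLp_opA H.toIsH2), coeFn_complexify (hsys.memLp i),
      Lp.coeFn_smul (lam i : ℂ) (complexify (hsys.memLp i)), he] with z h1 h2 h3 h4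
    rw [h1, h3, Pi.smul_apply, h2, h4, smul_eq_mul, Complex.ofReal_mul]
  rw [ParabolicPlant.inputVec_eq_inner H k, h1, inner_smul_left, Complex.conj_ofReal,
    hsys.basis_apply]

end ParabolicPlant

/-! ### Scalar modal equations and variation of constants. -/

theorem eq_of_hasDerivAt_zero_of_pos {E : Type*} [NormedAddCommGroup E] [NormedSpace ℝ E]
    {f : ℝ → E} (hc : ContinuousOn f (Set.Ici 0)) (hd : ∀ t, 0 < t → HasDerivAt f 0 t) {t : ℝ}
    (ht : 0 ≤ t) : f t = f 0 := by
  rcases ht.eq_or_lt with rfl | ht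
  · rfl
  have h1 : ∀ s ∈ Set.Ioc 0 t, f t = f s := fun s hs =>
    constant_of_has_deriv_right_zero (hc.mono fun y hy => hs.1.le.trans hy.1)
      (fun y hy => (hd y (hs.1.trans_le hy.1)).hasDerivWithinAt) t ⟨hs.2, le_rfl⟩
  have h2 : Filter.Tendsto f (nhdsWithin 0 (Set.Ioi 0)) (nhds (f 0)) :=
    (hc 0 Set.self_mem_Ici).mono Set.Ioi_subset_Ici_self
  refine tendsto_nhds_unique (Filter.Tendsto.congr' ?_ tendsto_const_nhds) h2
  filter_upwards [Ioc_mem_nhdsGT ht] with s hs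
  exact h1 s hs

/-- The solution of `y' = l y + f`, `y 0 = c`. -/
def varConst (l : ℝ) (c : ℂ) (f : ℝ → ℂ) (t : ℝ) : ℂ :=
  (Real.exp (l * t) : ℂ) * (c + ∫ s in (0 : ℝ)..t, (Real.exp (-l * s) : ℂ) * f s)

theorem hasDerivAt_ofReal_exp_mul (l t : ℝ) :
    HasDerivAt (fun t : ℝ => (Real.exp (l * t) : ℂ)) ((l : ℂ) * (Real.exp (l * t) : ℂ)) t := by
  have h := ((hasDerivAt_id t).const_mul l).exp.ofReal_comp
  convert! h using 1
  push_cast; simp; ring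

theorem hasDerivAt_integral_exp_mul (l : ℝ) {f : ℝ → ℂ} (hf : Continuous f) (t : ℝ) :
    HasDerivAt (fun t => ∫ s in (0 : ℝ)..t, (Real.exp (-l * s) : ℂ) * f s)
      ((Real.exp (-l * t) : ℂ) * f t) t := by
  have hc : Continuous fun s : ℝ => (Real.exp (-l * s) : ℂ) * f s := by fun_prop
  exact intervalIntegral.integral_hasDerivAt_right (hc.intervalIntegrable _ _)
    (hc.stronglyMeasurableAtFilter _ _) hc.continuousAt

theorem ofReal_exp_mul_exp_neg (l t : ℝ) :
    (Real.exp (l * t) : ℂ) * (Real.exp (-l * t) : ℂ) = 1 := by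
  rw [← Complex.ofReal_mul, ← Real.exp_add]; simp

theorem hasDerivAt_varConst (l : ℝ) (c : ℂ) {f : ℝ → ℂ} (hf : Continuous f) (t : ℝ) :
    HasDerivAt (varConst l c f) ((l : ℂ) * varConst l c f t + f t) t := by
  have h := (hasDerivAt_ofReal_exp_mul l t).mul ((hasDerivAt_integral_exp_mul l hf t).const_add c)
  convert! h using 1
  rw [varConst]
  linear_combination (-f t) * ofReal_exp_mul_exp_neg l t

theorem varConst_zero (l : ℝ) (c : ℂ) (f : ℝ → ℂ) : varConst l c f 0 = c := by
  simp [varConst]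

theorem continuous_varConst (l : ℝ) (c : ℂ) {f : ℝ → ℂ} (hf : Continuous f) :
    Continuous (varConst l c f) :=
  continuous_iff_continuousAt.2 fun t => (hasDerivAt_varConst l c hf t).continuousAt

/-- Integrating factor: e^{-lt}y(t) minus the integral has zero derivative for t > 0, and continuity
carries constancy down to t = 0. -/
theorem eq_varConst {l : ℝ} {f y : ℝ → ℂ} (hf : Continuous f) (hc : ContinuousOn y (Set.Ici 0))
    (hy : ∀ t, 0 < t → HasDerivAt y ((l : ℂ) * y t + f t) t) {t : ℝ} (ht : 0 ≤ t) :
    y t = varConst l (y 0) f t := by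
  have hd : ∀ t, 0 < t → HasDerivAt
      (fun t => (Real.exp (-l * t) : ℂ) * y t
        - ∫ s in (0 : ℝ)..t, (Real.exp (-l * s) : ℂ) * f s) 0 t := by
    intro t ht
    have h := ((hasDerivAt_ofReal_exp_mul (-l) t).mul (hy t ht)).sub
      (hasDerivAt_integral_exp_mul l hf t)
    convert! h using 1
    push_cast; ring
  have hint : Continuous fun t => ∫ s in (0 : ℝ)..t, (Real.exp (-l * s) : ℂ) * f s :=
    continuous_iff_continuousAt.2 fun t => (hasDerivAt_integral_exp_mul l hf t).continuousAt
  have h := eq_of_hasDerivAt_zero_of_pos (f := fun t => (Real.exp (-l * t) : ℂ) * y t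
      - ∫ s in (0 : ℝ)..t, (Real.exp (-l * s) : ℂ) * f s)
    (((by fun_prop : Continuous fun t : ℝ => (Real.exp (-l * t) : ℂ)).continuousOn.mul hc).sub
      hint.continuousOn) hd ht
  simp only [mul_zero, Real.exp_zero, Complex.ofReal_one, one_mul, intervalIntegral.integral_same,
    sub_zero] at h
  rw [varConst]
  linear_combination (Real.exp (l * t) : ℂ) * h - y t * ofReal_exp_mul_exp_neg l t

/-- Integrating e^{(α-l)s} yields the denominator α - l, which later compensates the factor λ_i in
the input vectors. -/
theorem norm_varConst_le {l α F : ℝ} {c : ℂ} {f : ℝ → ℂ} (hl : l < α)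
    (hF : ∀ t, 0 ≤ t → ‖f t‖ ≤ F * Real.exp (α * t)) {t : ℝ} (ht : 0 ≤ t) :
    ‖varConst l c f t‖ ≤ Real.exp (α * t) * (‖c‖ + F / (α - l)) := by
  have hpos : 0 < α - l := sub_pos.2 hl
  have hF0 : 0 ≤ F := by simpa using (norm_nonneg _).trans (hF 0 le_rfl)
  have h1 : ‖∫ s in (0 : ℝ)..t, (Real.exp (-l * s) : ℂ) * f s‖
      ≤ ∫ s in (0 : ℝ)..t, F * Real.exp ((α - l) * s) := by
    refine intervalIntegral.norm_integral_le_of_norm_le ht (Filter.Eventually.of_forall fun s hs => ?_)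
      ((by fun_prop : Continuous fun s => F * Real.exp ((α - l) * s)).intervalIntegrable _ _)
    rw [norm_mul, Complex.norm_real, Real.norm_of_nonneg (Real.exp_nonneg _)]
    calc Real.exp (-l * s) * ‖f s‖ ≤ Real.exp (-l * s) * (F * Real.exp (α * s)) := by
          gcongr; exact hF s hs.1.le
      _ = F * Real.exp ((α - l) * s) := by
          rw [sub_mul, sub_eq_neg_add, Real.exp_add, neg_mul]; ring
  have h2 : ∫ s in (0 : ℝ)..t, F * Real.exp ((α - l) * s)
      = F / (α - l) * (Real.exp ((α - l) * t) - 1) := by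
    rw [intervalIntegral.integral_eq_sub_of_hasDerivAt
      (f := fun s => F / (α - l) * Real.exp ((α - l) * s))]
    · simp; ring
    · intro s _
      have := (((hasDerivAt_id s).const_mul (α - l)).exp).const_mul (F / (α - l))
      convert! this using 1
      simp; field_simp
    · exact (by fun_prop : Continuous fun s => F * Real.exp ((α - l) * s)).intervalIntegrable _ _
  rw [h2] at h1
  have hq : 0 ≤ F / (α - l) := by positivity
  rw [varConst, norm_mul, Complex.norm_real, Real.norm_of_nonneg (Real.exp_nonneg _)]
  have h3 : Real.exp (l * t) * Real.exp ((α - l) * t) = Real.exp (α * t) := by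
    rw [← Real.exp_add]; ring_nf
  have h4 : Real.exp (l * t) ≤ Real.exp (α * t) := Real.exp_le_exp.2 (by nlinarith)
  calc _ ≤ Real.exp (l * t) * (‖c‖ + F / (α - l) * (Real.exp ((α - l) * t) - 1)) := by
        gcongr; exact (norm_add_le _ _).trans (by gcongr)
    _ = Real.exp (l * t) * ‖c‖
        + F / (α - l) * (Real.exp (l * t) * Real.exp ((α - l) * t) - Real.exp (l * t)) := by ring
    _ ≤ Real.exp (α * t) * ‖c‖ + F / (α - l) * Real.exp (α * t) := by
        rw [h3]; gcongr; linarith [Real.exp_pos (l * t)]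
    _ = _ := by ring

/-! ### Curves in a Hilbert space given by their modal coefficients. -/

theorem memlp_two_iff {E : Type*} [NormedAddCommGroup E] {a : ℕ → E} :
    Memℓp a 2 ↔ Summable fun i => ‖a i‖ ^ 2 := by
  rw [memℓp_gen_iff (by norm_num)]
  norm_num

section Hilbert

variable {H : Type*} [NormedAddCommGroup H] [InnerProductSpace ℂ H] (e : HilbertBasis ℕ ℂ H)

theorem HilbertBasis.hasSum_norm_sq (x : H) :
    HasSum (fun i => ‖inner ℂ (e i) x‖ ^ 2) (‖x‖ ^ 2) := by
  have h := Complex.hasSum_re (e.hasSum_inner_mul_inner x x)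
  rw [inner_self_eq_norm_sq_to_K] at h
  convert! h using 1
  · ext i
    rw [← inner_conj_symm, RCLike.norm_conj, RCLike.mul_conj]
    norm_cast
  · norm_cast

theorem HilbertBasis.memlp_norm_inner (x : H) : Memℓp (fun i => ‖inner ℂ (e i) x‖) 2 := by
  rw [memlp_two_iff]
  simpa using (e.hasSum_norm_sq x).summable

theorem summable_mul_of_memlp {a b : ℕ → ℝ} (ha : Memℓp a 2) (hb : Memℓp b 2) :
    Summable fun i => a i * b i := by
  rw [memlp_two_iff] at ha hb
  refine Summable.of_norm_bounded (ha.add hb) fun i => ?_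
  rw [norm_mul]
  nlinarith [sq_nonneg (‖a i‖ - ‖b i‖), sq_nonneg (‖a i‖ + ‖b i‖)]

/-- A family of continuous coefficients dominated by a square summable sequence defines a
continuous curve. -/
theorem HilbertBasis.exists_curve [CompleteSpace H] {Y : ℕ → ℝ → ℂ} {c : ℕ → ℝ} (hc : Memℓp c 2)
    (hY : ∀ i, Continuous (Y i)) (hb : ∀ i t, 0 ≤ t → ‖Y i t‖ ≤ c i) :
    ∃ x : ℝ → H, ContinuousOn x (Set.Ici 0) ∧ ∀ i t, 0 ≤ t → inner ℂ (e i) (x t) = Y i t := by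
  have hc2 := memlp_two_iff.1 hc
  have hb' : ∀ i t, ‖Y i (max t 0)‖ ≤ ‖c i‖ := fun i t =>
    (hb i _ (le_max_right _ _)).trans (le_abs_self _)
  have hmem : ∀ t, Memℓp (fun i => Y i (max t 0)) 2 := fun t => by
    rw [memlp_two_iff]
    refine Summable.of_nonneg_of_le (fun i => by positivity) (fun i => ?_) hc2
    have := hb' i t
    gcongr
  -- Freezing time at `max t 0` gives coefficients bounded for all real t, so a globally continuous
  -- curve can be built and then restricted.
  refine ⟨fun t => e.repr.symm ⟨_, hmem t⟩, Continuous.continuousOn ?_, fun i t ht => ?_⟩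
  · have hcoef : ∀ i t, inner ℂ (e i) (e.repr.symm ⟨_, hmem t⟩) = Y i (max t 0) := fun i t => by
      rw [← e.repr_apply_apply, LinearIsometryEquiv.apply_symm_apply]
    rw [continuous_iff_continuousAt]
    intro s
    -- By Parseval this series is the squared distance to the value at `s`; the majorant 4c_i² makes
    -- it continuous.
    have h1 : Continuous fun t => ∑' i, ‖Y i (max t 0) - Y i (max s 0)‖ ^ 2 := by
      refine continuous_tsum (u := fun i => 4 * ‖c i‖ ^ 2) (fun i => ?_) (hc2.mul_left 4)
        (fun i t => ?_)
      · have := hY i; fun_prop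
      · rw [norm_pow, norm_norm]
        have h := (norm_sub_le (Y i (max t 0)) (Y i (max s 0))).trans
          (add_le_add (hb' i t) (hb' i s))
        nlinarith [norm_nonneg (Y i (max t 0) - Y i (max s 0)), norm_nonneg (c i)]
    have h2 : ∀ t, ∑' i, ‖Y i (max t 0) - Y i (max s 0)‖ ^ 2
        = ‖e.repr.symm ⟨_, hmem t⟩ - e.repr.symm ⟨_, hmem s⟩‖ ^ 2 := fun t => by
      rw [← (e.hasSum_norm_sq _).tsum_eq]
      simp_rw [inner_sub_right, hcoef]
    simp_rw [h2] at h1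
    rw [ContinuousAt, tendsto_iff_norm_sub_tendsto_zero]
    have h3 := (h1.sqrt).tendsto s
    simpa [Real.sqrt_sq (norm_nonneg _)] using h3
  · rw [← e.repr_apply_apply, LinearIsometryEquiv.apply_symm_apply]
    change Y i (max t 0) = Y i t
    rw [max_eq_left ht]

/-- Termwise differentiation of `⟪h, x t⟫` for a curve `x` with coefficients satisfying the
modal equations. -/
theorem HilbertBasis.hasDerivAt_inner {m : ℕ} {lam : ℕ → ℝ} {b : ℕ → Fin m → ℂ} {A g : Fin m → H}
    (hb : ∀ i k, b i k = inner ℂ (e i) (A k) - (lam i : ℂ) * inner ℂ (e i) (g k))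
    {h Ah : H} (hAh : ∀ i, inner ℂ Ah (e i) = (lam i : ℂ) * inner ℂ h (e i))
    {x : ℝ → H} {u : Fin m → ℝ → ℂ} {c : ℕ → ℝ} (hc : Memℓp c 2) {U : ℝ}
    (hu : ∀ k t, 0 < t → ‖u k t‖ ≤ U)
    (hx : ∀ i t, 0 < t → ‖inner ℂ (e i) (x t)‖ ≤ c i)
    (hd : ∀ i t, 0 < t → HasDerivAt (fun s => inner ℂ (e i) (x s))
      ((lam i : ℂ) * inner ℂ (e i) (x t) + ∑ k, b i k * u k t) t) {t : ℝ} (ht : 0 < t) :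
    HasDerivAt (fun s => inner ℂ h (x s))
      (inner ℂ Ah (x t) + ∑ k, (inner ℂ h (A k) - inner ℂ Ah (g k)) * u k t) t := by
  set G : ℕ → ℝ → ℂ := fun i s => inner ℂ h (e i) * inner ℂ (e i) (x s) with hG
  -- The formal derivative with each λ_i absorbed into the coefficients of `Ah`. Only products of
  -- two ℓ² sequences remain, so the series is dominated uniformly in time.
  set G' : ℕ → ℝ → ℂ := fun i s => inner ℂ Ah (e i) * inner ℂ (e i) (x s)
    + ∑ k, (inner ℂ h (e i) * inner ℂ (e i) (A k) - inner ℂ Ah (e i) * inner ℂ (e i) (g k)) * u k s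
    with hG'
  have hGd : ∀ i s, s ∈ Set.Ioi (0 : ℝ) → HasDerivAt (G i) (G' i s) s := by
    intro i s hs
    have h1 := (hd i s hs).const_mul (inner ℂ h (e i))
    convert! h1 using 1
    rw [hG']
    simp only [hb, hAh, mul_add, Finset.mul_sum]
    congr 1
    · ring
    · refine Finset.sum_congr rfl fun k _ => ?_
      ring
  have hAhn : Memℓp (fun i => ‖inner ℂ Ah (e i)‖) 2 := by
    simp_rw [norm_inner_symm Ah]
    exact e.memlp_norm_inner Ah
  have hbound : ∀ i s, s ∈ Set.Ioi (0 : ℝ) → ‖G' i s‖ ≤ ‖inner ℂ Ah (e i)‖ * c i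
      + ∑ k, ‖inner ℂ h (e i) * inner ℂ (e i) (A k) - inner ℂ Ah (e i) * inner ℂ (e i) (g k)‖ * U := by
    intro i s hs
    refine (norm_add_le _ _).trans (add_le_add ?_ ((norm_sum_le _ _).trans
      (Finset.sum_le_sum fun k _ => ?_)))
    · rw [norm_mul]
      exact mul_le_mul_of_nonneg_left (hx i s hs) (norm_nonneg _)
    · rw [norm_mul]
      exact mul_le_mul_of_nonneg_left (hu k s hs) (norm_nonneg _)
  have hsum : Summable fun i => ‖inner ℂ Ah (e i)‖ * c i
      + ∑ k, ‖inner ℂ h (e i) * inner ℂ (e i) (A k) - inner ℂ Ah (e i) * inner ℂ (e i) (g k)‖ * U :=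
    (summable_mul_of_memlp hAhn hc).add (summable_sum fun k _ =>
      (((e.summable_inner_mul_inner h (A k)).sub
        (e.summable_inner_mul_inner Ah (g k))).norm.mul_right U))
  have key := hasDerivAt_tsum_of_isPreconnected hsum isOpen_Ioi isPreconnected_Ioi hGd hbound
    (Set.mem_Ioi.2 ht) (e.summable_inner_mul_inner h (x t)) (Set.mem_Ioi.2 ht)
  have h1 : (fun z => ∑' i, G i z) = fun z => inner ℂ h (x z) := by
    ext z
    exact (e.hasSum_inner_mul_inner h (x z)).tsum_eq
  have h2 : ∑' i, G' i t = inner ℂ Ah (x t)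
      + ∑ k, (inner ℂ h (A k) - inner ℂ Ah (g k)) * u k t :=
    ((e.hasSum_inner_mul_inner Ah (x t)).add (hasSum_sum fun k _ =>
      ((e.hasSum_inner_mul_inner h (A k)).sub
        (e.hasSum_inner_mul_inner Ah (g k))).mul_right _)).tsum_eq
  rwa [h1, h2] at key

/-- Modal trajectories for exponentially decaying inputs, with a uniform decay estimate. -/
theorem HilbertBasis.exists_modal_trajectory [CompleteSpace H] {m : ℕ} {lam : ℕ → ℝ}
    {b : ℕ → Fin m → ℂ} {A g : Fin m → H}
    (hb : ∀ i k, b i k = inner ℂ (e i) (A k) - (lam i : ℂ) * inner ℂ (e i) (g k))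
    {n : ℕ} {α δ : ℝ} (hα : α ≤ 0) (hδ : 0 < δ) (hlam : ∀ i, n ≤ i → lam i ≤ α - δ)
    {C C' : ℝ} (hC' : 0 ≤ C') :
    ∃ M : ℝ, 1 ≤ M ∧ ∀ (x0 : H) (u : Fin m → ℝ → ℂ), (∀ k, Continuous (u k)) →
      (∀ k t, 0 ≤ t → ‖u k t‖ ≤ C' * Real.exp (α * t) * ‖x0‖) →
      (∀ i, i < n → ∀ t, 0 ≤ t →
        ‖varConst (lam i) (inner ℂ (e i) x0) (fun s => ∑ k, b i k * u k s) t‖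
          ≤ C * Real.exp (α * t) * ‖x0‖) →
      ∃ x : ℝ → H, ContinuousOn x (Set.Ici 0) ∧
        (∀ i t, 0 ≤ t → inner ℂ (e i) (x t)
          = varConst (lam i) (inner ℂ (e i) x0) (fun s => ∑ k, b i k * u k s) t) ∧
        (∀ t, 0 ≤ t → ‖x t‖ ≤ M * Real.exp (α * t) * ‖x0‖) ∧
        ∀ h Ah : H, (∀ i, inner ℂ Ah (e i) = (lam i : ℂ) * inner ℂ h (e i)) → ∀ t, 0 < t →
          HasDerivAt (fun s => inner ℂ h (x s))
            (inner ℂ Ah (x t) + ∑ k, (inner ℂ h (A k) - inner ℂ Ah (g k)) * u k t) t := by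
  -- Square summable majorant of ‖b_i‖/(α - λ_i) for i ≥ n: use |λ_i| ≤ |α| + (α - λ_i) and α - λ_i
  -- ≥ δ.
  set r : ℕ → ℝ := fun i => ∑ k, (δ⁻¹ * (‖inner ℂ (e i) (A k)‖ + |α| * ‖inner ℂ (e i) (g k)‖)
    + ‖inner ℂ (e i) (g k)‖) with hr
  have hr_mem : Memℓp r 2 := by
    refine Memℓp.finsetSum _ fun k _ => ?_
    exact (((e.memlp_norm_inner (A k)).add ((e.memlp_norm_inner (g k)).const_mul |α|)).const_mul
      δ⁻¹).add (e.memlp_norm_inner (g k))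
  set D : ℕ → ℝ := fun i => (if i < n then C else 0) + C' * r i with hD
  have hD_mem : Memℓp D 2 := by
    refine Memℓp.add ?_ (hr_mem.const_mul C')
    rw [memlp_two_iff]
    refine summable_of_ne_finset_zero (s := Finset.range n) fun i hi => ?_
    rw [Finset.mem_range] at hi
    simp [hi]
  have hr0 : ∀ i, 0 ≤ r i := fun i => Finset.sum_nonneg fun k _ => by positivity
  have hD2 := memlp_two_iff.1 hD_mem
  have hS : 0 ≤ ∑' i, ‖D i‖ ^ 2 := tsum_nonneg fun i => by positivity
  -- From (a + b)² ≤ 2a² + 2b² applied mode by mode and summed by Parseval.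
  refine ⟨Real.sqrt (2 + 2 * ∑' i, ‖D i‖ ^ 2), Real.one_le_sqrt.2 (by linarith), ?_⟩
  intro x0 u hu hub hlow
  set f : ℕ → ℝ → ℂ := fun i s => ∑ k, b i k * u k s with hf
  have hfc : ∀ i, Continuous (f i) := fun i => by
    exact continuous_finsetSum _ fun k _ => continuous_const.mul (hu k)
  have hfb : ∀ i t, 0 ≤ t → ‖f i t‖ ≤ (∑ k, ‖b i k‖) * (C' * ‖x0‖) * Real.exp (α * t) := by
    intro i t ht
    calc ‖f i t‖ ≤ ∑ k, ‖b i k * u k t‖ := norm_sum_le _ _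
      _ ≤ ∑ k, ‖b i k‖ * (C' * Real.exp (α * t) * ‖x0‖) := by
          refine Finset.sum_le_sum fun k _ => ?_
          rw [norm_mul]
          exact mul_le_mul_of_nonneg_left (hub k t ht) (norm_nonneg _)
      _ = _ := by rw [← Finset.sum_mul]; ring
  have hbr : ∀ i, n ≤ i → (∑ k, ‖b i k‖) / (α - lam i) ≤ r i := by
    intro i hi
    have hl := hlam i hi
    have hpos : 0 < α - lam i := by linarith
    rw [Finset.sum_div]
    refine Finset.sum_le_sum fun k _ => ?_
    have h1 : ‖b i k‖ ≤ ‖inner ℂ (e i) (A k)‖ + |α| * ‖inner ℂ (e i) (g k)‖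
        + (α - lam i) * ‖inner ℂ (e i) (g k)‖ := by
      rw [hb]
      refine (norm_sub_le _ _).trans ?_
      rw [norm_mul, Complex.norm_real, add_assoc, ← add_mul]
      gcongr
      rw [Real.norm_eq_abs]
      calc |lam i| = |α - (α - lam i)| := by ring_nf
        _ ≤ |α| + |α - lam i| := abs_sub _ _
        _ = _ := by rw [abs_of_pos hpos]
    rw [div_le_iff₀ hpos]
    refine h1.trans ?_
    rw [add_mul]
    have h2 : 1 ≤ δ⁻¹ * (α - lam i) := by
      rw [inv_mul_eq_div, le_div_iff₀ hδ]; linarith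
    have h3 : 0 ≤ ‖inner ℂ (e i) (A k)‖ + |α| * ‖inner ℂ (e i) (g k)‖ := by positivity
    nlinarith
  have hYb : ∀ i t, 0 ≤ t → ‖varConst (lam i) (inner ℂ (e i) x0) (f i) t‖
      ≤ Real.exp (α * t) * (‖inner ℂ (e i) x0‖ + ‖x0‖ * ‖D i‖) := by
    intro i t ht
    have hE := Real.exp_pos (α * t)
    by_cases hi : i < n
    · calc _ ≤ C * Real.exp (α * t) * ‖x0‖ := hlow i hi t ht
        _ ≤ ‖D i‖ * Real.exp (α * t) * ‖x0‖ := by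
            gcongr
            refine le_trans ?_ (le_abs_self _)
            simp only [hD, hi, if_true]
            have := mul_nonneg hC' (hr0 i)
            linarith
        _ = Real.exp (α * t) * (0 + ‖x0‖ * ‖D i‖) := by ring
        _ ≤ _ := by gcongr; positivity
    · push Not at hi
      have hl := hlam i hi
      refine (norm_varConst_le (by linarith) (hfb i) ht).trans ?_
      gcongr
      calc (∑ k, ‖b i k‖) * (C' * ‖x0‖) / (α - lam i)
          = (∑ k, ‖b i k‖) / (α - lam i) * (C' * ‖x0‖) := by ring
        _ ≤ r i * (C' * ‖x0‖) := by gcongr; exact hbr i hi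
        _ = ‖x0‖ * (C' * r i) := by ring
        _ ≤ ‖x0‖ * ‖D i‖ := by
            gcongr
            refine le_trans ?_ (le_abs_self _)
            simp [hD, hi.not_gt]
  have hDn : Memℓp (fun i => ‖D i‖) 2 := by
    rw [memlp_two_iff]; simpa using hD2
  set c : ℕ → ℝ := fun i => ‖inner ℂ (e i) x0‖ + ‖x0‖ * ‖D i‖ with hc
  have hc_mem : Memℓp c 2 := (e.memlp_norm_inner x0).add (hDn.const_mul ‖x0‖)
  have hYc : ∀ i t, 0 ≤ t → ‖varConst (lam i) (inner ℂ (e i) x0) (f i) t‖ ≤ c i := by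
    intro i t ht
    refine (hYb i t ht).trans ?_
    have hc0 : 0 ≤ c i := by positivity
    -- Here α ≤ 0 turns the decay bound into one uniform in time.
    have : Real.exp (α * t) ≤ 1 := Real.exp_le_one_iff.2 (mul_nonpos_of_nonpos_of_nonneg hα ht)
    exact mul_le_of_le_one_left hc0 this
  obtain ⟨x, hxc, hx⟩ := e.exists_curve hc_mem
    (fun i => continuous_varConst (lam i) (inner ℂ (e i) x0) (hfc i)) hYc
  refine ⟨x, hxc, hx, fun t ht => ?_, fun h Ah hAh t ht => ?_⟩
  · have hE := Real.exp_pos (α * t)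
    have h1 : ‖x t‖ ^ 2 ≤ Real.exp (α * t) ^ 2 * (2 * ‖x0‖ ^ 2 + 2 * ‖x0‖ ^ 2 * ∑' i, ‖D i‖ ^ 2) := by
      have hs := (((e.hasSum_norm_sq x0).mul_left 2).add
        (hD2.hasSum.mul_left (2 * ‖x0‖ ^ 2))).mul_left (Real.exp (α * t) ^ 2)
      refine hasSum_le (fun i => ?_) (e.hasSum_norm_sq (x t)) hs
      rw [hx i t ht]
      calc _ ≤ (Real.exp (α * t) * (‖inner ℂ (e i) x0‖ + ‖x0‖ * ‖D i‖)) ^ 2 :=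
            pow_le_pow_left₀ (norm_nonneg _) (hYb i t ht) 2
        _ ≤ _ := by
            rw [mul_pow]
            gcongr
            nlinarith [sq_nonneg (‖inner ℂ (e i) x0‖ - ‖x0‖ * ‖D i‖)]
    refine le_of_sq_le_sq ?_ (by positivity)
    rw [mul_pow, mul_pow, Real.sq_sqrt (by linarith)]
    refine h1.trans (le_of_eq (by ring))
  · refine e.hasDerivAt_inner hb hAh hc_mem (U := C' * ‖x0‖) (fun k s hs => ?_) (fun i s hs => ?_)
      (fun i s hs => ?_) ht
    · refine (hub k s hs.le).trans ?_
      have : Real.exp (α * s) ≤ 1 :=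
        Real.exp_le_one_iff.2 (mul_nonpos_of_nonpos_of_nonneg hα hs.le)
      calc C' * Real.exp (α * s) * ‖x0‖ ≤ C' * 1 * ‖x0‖ := by gcongr
        _ = _ := by ring
    · rw [hx i s hs.le]; exact hYc i s hs.le
    · rw [hx i s hs.le]
      refine (hasDerivAt_varConst (lam i) (inner ℂ (e i) x0) (hfc i) s).congr_of_eventuallyEq ?_
      filter_upwards [lt_mem_nhds hs] with z hz
      exact hx i z hz.le

end Hilbert

/-! ### Real matrices acting on complex vectors. -/

section ComplexMulVec

variable {l m n : ℕ}

/-- A real matrix as an operator between complex Euclidean spaces. -/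
def complexMulVec (X : Matrix (Fin m) (Fin n) ℝ) :
    EuclideanSpace ℂ (Fin n) →L[ℂ] EuclideanSpace ℂ (Fin m) :=
  (Matrix.toEuclideanLin (X.map fun r : ℝ => (r : ℂ))).toContinuousLinearMap

theorem complexMulVec_apply (X : Matrix (Fin m) (Fin n) ℝ) (v : EuclideanSpace ℂ (Fin n))
    (i : Fin m) : complexMulVec X v i = ∑ j, (X i j : ℂ) * v j := by
  simp [complexMulVec, Matrix.mulVec, dotProduct, Matrix.toLpLin_apply]

theorem complexMulVec_add (X Y : Matrix (Fin m) (Fin n) ℝ) (v : EuclideanSpace ℂ (Fin n)) :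
    complexMulVec (X + Y) v = complexMulVec X v + complexMulVec Y v := by
  ext i
  simp [complexMulVec_apply, add_mul, Finset.sum_add_distrib]

theorem complexMulVec_mul (X : Matrix (Fin l) (Fin m) ℝ) (Y : Matrix (Fin m) (Fin n) ℝ)
    (v : EuclideanSpace ℂ (Fin n)) :
    complexMulVec (X * Y) v = complexMulVec X (complexMulVec Y v) := by
  ext i
  simp only [complexMulVec_apply, Matrix.mul_apply, Complex.ofReal_sum, Complex.ofReal_mul,
    Finset.sum_mul, Finset.mul_sum]
  rw [Finset.sum_comm]
  simp_rw [mul_assoc]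

theorem complexMulVec_neg_one (v : EuclideanSpace ℂ (Fin n)) :
    complexMulVec (-1 : Matrix (Fin n) (Fin n) ℝ) v = -v := by
  ext i
  simp [complexMulVec_apply, Matrix.one_apply, apply_ite (Complex.ofReal)]

theorem complexMulVec_one (v : EuclideanSpace ℂ (Fin n)) :
    complexMulVec (1 : Matrix (Fin n) (Fin n) ℝ) v = v := by
  ext i
  simp [complexMulVec_apply, Matrix.one_apply, apply_ite (Complex.ofReal)]

theorem inner_complexMulVec (X : Matrix (Fin m) (Fin n) ℝ) (v : EuclideanSpace ℂ (Fin m))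
    (w : EuclideanSpace ℂ (Fin n)) :
    inner ℂ v (complexMulVec X w) = inner ℂ (complexMulVec X.transpose v) w := by
  simp only [PiLp.inner_apply, RCLike.inner_apply, complexMulVec_apply, map_sum, map_mul,
    Complex.conj_ofReal, Finset.sum_mul, Finset.mul_sum, Matrix.transpose_apply]
  rw [Finset.sum_comm]
  refine Finset.sum_congr rfl fun i _ => Finset.sum_congr rfl fun j _ => ?_
  ring

/-- A real matrix acts separately on real and imaginary parts, so the real spectral norm also bounds
its complex action. -/
theorem norm_complexMulVec_le (X : Matrix (Fin m) (Fin n) ℝ) (v : EuclideanSpace ℂ (Fin n)) :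
    ‖complexMulVec X v‖ ≤ ‖X‖ * ‖v‖ := by
  have key : ∀ y : EuclideanSpace ℝ (Fin n),
      ∑ i, (∑ j, X i j * y j) ^ 2 ≤ ‖X‖ ^ 2 * ∑ j, y j ^ 2 := by
    intro y
    have h := pow_le_pow_left₀ (norm_nonneg _) (X.l2_opNorm_mulVec y) 2
    rw [mul_pow, EuclideanSpace.real_norm_sq_eq, EuclideanSpace.real_norm_sq_eq] at h
    simpa [Matrix.mulVec, dotProduct] using h
  have hre := key (WithLp.toLp 2 fun j => (v j).re)
  have him := key (WithLp.toLp 2 fun j => (v j).im)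
  refine le_of_sq_le_sq ?_ (by positivity)
  rw [mul_pow, EuclideanSpace.norm_sq_eq, EuclideanSpace.norm_sq_eq]
  simp_rw [← Complex.normSq_eq_norm_sq, Complex.normSq_apply, ← sq]
  rw [Finset.sum_add_distrib, Finset.sum_add_distrib, mul_add]
  refine add_le_add ?_ ?_
  · simpa [complexMulVec_apply] using hre
  · simpa [complexMulVec_apply] using him

end ComplexMulVec

/-! ### Largest eigenvalue and factorization of positive definite matrices. -/

section LambdaMax

variable {n : ℕ} {A : Matrix (Fin n) (Fin n) ℝ}

theorem le_lambdaMax (hA : A.IsHermitian) (i : Fin n) : hA.eigenvalues i ≤ lambdaMax A := by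
  rw [lambdaMax, hA.spectrum_real_eq_range_eigenvalues]
  exact le_csSup (Set.finite_range _).bddAbove ⟨i, rfl⟩

theorem lambdaMax_pos (hn : 1 ≤ n) (hA : A.PosDef) : 0 < lambdaMax A :=
  (hA.eigenvalues_pos ⟨0, hn⟩).trans_le (le_lambdaMax hA.isHermitian _)

theorem norm_le_lambdaMax (hn : 1 ≤ n) (hA : A.PosDef) : ‖A‖ ≤ lambdaMax A := by
  have h := hA.isHermitian.spectral_theorem
  have h' := congrArg norm h
  rw [Unitary.conjStarAlgAut_apply, ← Unitary.coe_star, CStarRing.norm_mul_coe_unitary,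
    CStarRing.norm_coe_unitary_mul, Matrix.l2_opNorm_diagonal] at h'
  rw [h']
  refine (pi_norm_le_iff_of_nonneg (lambdaMax_pos hn hA).le).2 fun i => ?_
  simp only [Function.comp_apply]
  rw [RCLike.norm_ofReal, abs_of_pos (hA.eigenvalues_pos i)]
  exact le_lambdaMax hA.isHermitian i

end LambdaMax

-- The factorization writes the Lyapunov function as ‖Qv‖²; the left inverse R recovers ‖v‖ from it
-- without a smallest eigenvalue.
open scoped MatrixOrder in
theorem Matrix.PosDef.exists_eq_transpose_mul {n : ℕ} {A : Matrix (Fin n) (Fin n) ℝ}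
    (hA : A.PosDef) : ∃ Q R : Matrix (Fin n) (Fin n) ℝ, A = Q.transpose * Q ∧ R * Q = 1 := by
  obtain ⟨Q, hQ⟩ := CStarAlgebra.nonneg_iff_eq_star_mul_self.mp hA.posSemidef.nonneg
  have hQ' : A = Q.transpose * Q := by
    rw [hQ, Matrix.star_eq_conjTranspose, Matrix.conjTranspose_eq_transpose_of_trivial]
  refine ⟨Q, A⁻¹ * Q.transpose, hQ', ?_⟩
  rw [Matrix.mul_assoc, ← hQ']
  exact Matrix.nonsing_inv_mul _ ((Matrix.isUnit_iff_isUnit_det _).1 hA.isUnit)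

/-! ### Lyapunov estimate for the first n modes. -/

section Lyapunov

variable {n : ℕ} {L Lhat Pi : Matrix (Fin n) (Fin n) ℝ} {B Bhat : Matrix (Fin n) (Fin 2) ℝ}
  {K : Matrix (Fin 2) (Fin n) ℝ} {c : ℝ}

/-- The Lyapunov inequality for the perturbed closed loop `v ↦ L v - B K S v`. -/
theorem lyapunov_inequality (hn : 1 ≤ n) (hPi : Pi.PosDef)
    (hLyap : (Lhat - Bhat * K).transpose * Pi + Pi * (Lhat - Bhat * K) = -1)
    {v w : EuclideanSpace ℂ (Fin n)} (hw : ‖v - w‖ ≤ c * ‖v‖) :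
    2 * (inner ℂ v (complexMulVec Pi (complexMulVec L v - complexMulVec (B * K) w))).re
      ≤ gammaConst L Lhat B Bhat K Pi c * ‖v‖ ^ 2 := by
  set Ahat := Lhat - Bhat * K with hAhat
  have hT : Pi.transpose = Pi := by
    have := hPi.isHermitian.eq
    rwa [Matrix.conjTranspose_eq_transpose_of_trivial] at this
  -- Nominal closed loop, parameter error, and observation error: these give the terms -1, the one
  -- with λ_max(Π), and the one with c in γ.
  have hdecomp : complexMulVec Pi (complexMulVec L v - complexMulVec (B * K) w)
      = complexMulVec (Pi * Ahat) v + complexMulVec (Pi * ((L - Lhat) - (B - Bhat) * K)) v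
        + complexMulVec (Pi * B * K) (v - w) := by
    have h1 : L = Ahat + ((L - Lhat) - (B - Bhat) * K) + B * K := by
      rw [hAhat, Matrix.sub_mul]; abel
    rw [Matrix.mul_assoc Pi B K, complexMulVec_mul Pi Ahat, complexMulVec_mul Pi,
      complexMulVec_mul Pi (B * K), ← map_add, ← map_add]
    congr 1
    conv_lhs => rw [h1]
    rw [complexMulVec_add, complexMulVec_add, map_sub]
    abel
  have h1 : 2 * (inner ℂ v (complexMulVec (Pi * Ahat) v)).re = -‖v‖ ^ 2 := by
    have e1 : inner ℂ v (complexMulVec (Ahat.transpose * Pi + Pi * Ahat) v) = -(‖v‖ ^ 2 : ℂ) := by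
      rw [hLyap, complexMulVec_neg_one, inner_neg_right, inner_self_eq_norm_sq_to_K]
      rfl
    rw [complexMulVec_add, inner_add_right] at e1
    have e2 : inner ℂ v (complexMulVec (Ahat.transpose * Pi) v)
        = (starRingEnd ℂ) (inner ℂ v (complexMulVec (Pi * Ahat) v)) := by
      rw [inner_conj_symm, inner_complexMulVec, Matrix.transpose_mul, Matrix.transpose_transpose, hT]
    -- The two terms of the Lyapunov equation are conjugate numbers, so each has half the real part.
    rw [e2] at e1
    have e3 := congrArg Complex.re e1
    rw [Complex.add_re, Complex.conj_re] at e3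
    have e4 : (-(‖v‖ ^ 2 : ℂ)).re = -‖v‖ ^ 2 := by norm_cast
    rw [e4] at e3
    linarith
  have hre : ∀ a b : EuclideanSpace ℂ (Fin n), (inner ℂ a b).re ≤ ‖a‖ * ‖b‖ := fun a b =>
    (Complex.re_le_norm _).trans (norm_inner_le_norm a b)
  have hPn := norm_le_lambdaMax hn hPi
  have h2 : (inner ℂ v (complexMulVec (Pi * ((L - Lhat) - (B - Bhat) * K)) v)).re
      ≤ (‖L - Lhat‖ + ‖B - Bhat‖ * ‖K‖) * lambdaMax Pi * ‖v‖ ^ 2 := by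
    have e1 : ‖Pi * ((L - Lhat) - (B - Bhat) * K)‖
        ≤ lambdaMax Pi * (‖L - Lhat‖ + ‖B - Bhat‖ * ‖K‖) := by
      refine (Matrix.l2_opNorm_mul _ _).trans (mul_le_mul hPn ?_ (norm_nonneg _)
        ((norm_nonneg _).trans hPn))
      exact (norm_sub_le _ _).trans (add_le_add le_rfl (Matrix.l2_opNorm_mul _ _))
    calc _ ≤ ‖v‖ * ‖complexMulVec (Pi * ((L - Lhat) - (B - Bhat) * K)) v‖ := hre _ _
      _ ≤ ‖v‖ * (lambdaMax Pi * (‖L - Lhat‖ + ‖B - Bhat‖ * ‖K‖) * ‖v‖) := by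
          gcongr
          exact (norm_complexMulVec_le _ _).trans (by gcongr)
      _ = _ := by ring
  have h3 : (inner ℂ v (complexMulVec (Pi * B * K) (v - w))).re
      ≤ c * ‖Pi * B * K‖ * ‖v‖ ^ 2 := by
    calc _ ≤ ‖v‖ * ‖complexMulVec (Pi * B * K) (v - w)‖ := hre _ _
      _ ≤ ‖v‖ * (‖Pi * B * K‖ * (c * ‖v‖)) := by
          gcongr
          exact (norm_complexMulVec_le _ _).trans (by gcongr)
      _ = _ := by ring
  rw [hdecomp, inner_add_right, inner_add_right, Complex.add_re, Complex.add_re, gammaConst]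
  nlinarith

/-- Exponential decay of the trajectories of a linear system with a quadratic Lyapunov function. -/
theorem exists_decay_of_lyapunov (hn : 1 ≤ n) (hPi : Pi.PosDef) {γ α : ℝ}
    (hα : α = γ / (2 * lambdaMax Pi)) (hα0 : α < 0)
    {T : EuclideanSpace ℂ (Fin n) →L[ℂ] EuclideanSpace ℂ (Fin n)}
    (hT : ∀ v, 2 * (inner ℂ v (complexMulVec Pi (T v))).re ≤ γ * ‖v‖ ^ 2) :
    ∃ C : ℝ, 0 ≤ C ∧ ∀ p : ℝ → EuclideanSpace ℂ (Fin n), ContinuousOn p (Set.Ici 0) →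
      (∀ t, 0 < t → HasDerivAt p (T (p t)) t) →
      ∀ t, 0 ≤ t → ‖p t‖ ≤ C * Real.exp (α * t) * ‖p 0‖ := by
  obtain ⟨Q, R, hQ, hR⟩ := hPi.exists_eq_transpose_mul
  have hpos := lambdaMax_pos hn hPi
  have hγ : γ = 2 * lambdaMax Pi * α := by rw [hα]; field_simp
  have hV : ∀ v w, inner ℂ (complexMulVec Q v) (complexMulVec Q w)
      = inner ℂ v (complexMulVec Pi w) := by
    intro v w
    rw [inner_complexMulVec, ← complexMulVec_mul, ← hQ, inner_complexMulVec]
    have := hPi.isHermitian.eq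
    rw [Matrix.conjTranspose_eq_transpose_of_trivial] at this
    rw [this]
  have hVle : ∀ v, ‖complexMulVec Q v‖ ^ 2 ≤ lambdaMax Pi * ‖v‖ ^ 2 := by
    intro v
    have h1 : ‖complexMulVec Q v‖ ^ 2 = (inner ℂ v (complexMulVec Pi v)).re := by
      rw [← hV, inner_self_eq_norm_sq_to_K]; norm_cast
    rw [h1]
    calc _ ≤ ‖v‖ * ‖complexMulVec Pi v‖ :=
          (Complex.re_le_norm _).trans (norm_inner_le_norm _ _)
      _ ≤ ‖v‖ * (lambdaMax Pi * ‖v‖) := by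
          gcongr
          exact (norm_complexMulVec_le _ _).trans (by gcongr; exact norm_le_lambdaMax hn hPi)
      _ = _ := by ring
  refine ⟨‖R‖ * ‖Q‖, by positivity, fun p hpc hp t ht => ?_⟩
  set W : ℝ → ℝ := fun t => Real.exp (-(2 * α) * t) * (inner ℂ (complexMulVec Q (p t))
    (complexMulVec Q (p t))).re with hW
  have hWn : ∀ t, W t = (Real.exp (-α * t) * ‖complexMulVec Q (p t)‖) ^ 2 := by
    intro t
    rw [hW, mul_pow, ← Real.exp_nat_mul]
    simp only [inner_self_eq_norm_sq_to_K]
    congr 1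
    · congr 1; push_cast; ring
    · norm_cast
  have hQp : ∀ t, 0 < t → HasDerivAt (fun t => complexMulVec Q (p t)) (complexMulVec Q (T (p t))) t :=
    fun t ht =>
      ((complexMulVec Q).restrictScalars ℝ).hasFDerivAt.comp_hasDerivAt t (hp t ht)
  have hWd : ∀ t, 0 < t → HasDerivAt W (Real.exp (-(2 * α) * t)
      * (2 * (inner ℂ (p t) (complexMulVec Pi (T (p t)))).re
        - 2 * α * ‖complexMulVec Q (p t)‖ ^ 2)) t := by
    intro t ht
    have h1 := (hQp t ht).inner ℂ (hQp t ht)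
    have h2 := Complex.reCLM.hasFDerivAt.comp_hasDerivAt t h1
    have h3 := (((hasDerivAt_id t).const_mul (-(2 * α))).exp).mul h2
    convert! h3 using 1
    simp only [Function.comp_apply, Complex.reCLM_apply, Complex.add_re, hV]
    have h4 : (inner ℂ (T (p t)) (complexMulVec Pi (p t))).re
        = (inner ℂ (p t) (complexMulVec Pi (T (p t)))).re := by
      rw [← hV, ← hV, ← inner_conj_symm, Complex.conj_re]
    have h5 : (inner ℂ (p t) (complexMulVec Pi (p t))).re = ‖complexMulVec Q (p t)‖ ^ 2 := by
      rw [← hV, inner_self_eq_norm_sq_to_K]; norm_cast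
    rw [h4, h5]
    simp
    ring
  have hWc : ContinuousOn W (Set.Ici 0) := by
    have : ContinuousOn (fun t => complexMulVec Q (p t)) (Set.Ici 0) :=
      (complexMulVec Q).continuous.comp_continuousOn hpc
    exact (by fun_prop : Continuous fun t : ℝ => Real.exp (-(2 * α) * t)).continuousOn.mul
      (Complex.continuous_re.comp_continuousOn (ContinuousOn.inner (𝕜 := ℂ) this this))
  have hWanti : AntitoneOn W (Set.Ici 0) := by
    refine antitoneOn_of_deriv_nonpos (convex_Ici 0) hWc ?_ ?_
    · rw [interior_Ici]
      exact fun s hs => (hWd s hs).differentiableAt.differentiableWithinAt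
    · rw [interior_Ici]
      intro s hs
      rw [(hWd s hs).deriv]
      -- With γ = 2λ_max α, the claim is γ‖p‖² ≤ 2α‖Qp‖². It follows from ‖Qp‖² ≤ λ_max‖p‖² because
      -- α < 0 reverses that inequality.
      refine mul_nonpos_of_nonneg_of_nonpos (Real.exp_nonneg _) ?_
      have h1 := hT (p s)
      have h2 := hVle (p s)
      rw [hγ] at h1
      nlinarith
  have h1 := hWanti (Set.self_mem_Ici) (Set.mem_Ici.2 ht) ht
  rw [hWn, hWn] at h1
  have h2 : Real.exp (-α * t) * ‖complexMulVec Q (p t)‖ ≤ ‖complexMulVec Q (p 0)‖ := by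
    have := le_of_sq_le_sq h1 (by positivity)
    simpa using this
  have h3 : ‖complexMulVec Q (p t)‖ ≤ Real.exp (α * t) * ‖complexMulVec Q (p 0)‖ := by
    calc _ = Real.exp (α * t) * (Real.exp (-α * t) * ‖complexMulVec Q (p t)‖) := by
          rw [← mul_assoc, ← Real.exp_add]; simp
      _ ≤ _ := by gcongr
  calc ‖p t‖ = ‖complexMulVec R (complexMulVec Q (p t))‖ := by
        rw [← complexMulVec_mul, hR, complexMulVec_one]
    _ ≤ ‖R‖ * ‖complexMulVec Q (p t)‖ := norm_complexMulVec_le _ _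
    _ ≤ ‖R‖ * (Real.exp (α * t) * (‖Q‖ * ‖p 0‖)) := by
        gcongr
        exact h3.trans (by gcongr; exact norm_complexMulVec_le _ _)
    _ = _ := by ring

end Lyapunov

/-! ### Reduction of the feedback to the first n modes. -/

theorem exists_linear_flow {E : Type*} [NormedAddCommGroup E] [NormedSpace ℂ E] [CompleteSpace E]
    (T : E →L[ℂ] E) (p0 : E) :
    ∃ p : ℝ → E, p 0 = p0 ∧ ∀ t, HasDerivAt p (T (p t)) t := by
  refine ⟨fun t => NormedSpace.exp (t • T) p0, by simp, fun t => ?_⟩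
  have h := hasDerivAt_exp_smul_const' (𝕂 := ℝ) T t
  exact ((ContinuousLinearMap.apply ℂ E p0).restrictScalars ℝ).hasFDerivAt.comp_hasDerivAt t h

theorem HilbertBasis.ext_inner {H : Type*} [NormedAddCommGroup H] [InnerProductSpace ℂ H]
    (e : HilbertBasis ℕ ℂ H) {x y : H} (h : ∀ i, inner ℂ (e i) x = inner ℂ (e i) y) : x = y := by
  refine e.repr.injective ?_
  ext i
  rw [e.repr_apply_apply, e.repr_apply_apply, h i]

section Feedback

variable {n : ℕ} {psi : Fin n → ℝ → ℝ}

/-- The vector of observables as a linear map. -/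
def functionalVecₗ (hpsi : ∀ i, MemLp (psi i) 2 unitVol) :
    StateSpace →ₗ[ℂ] EuclideanSpace ℂ (Fin n) where
  toFun := functionalVec psi
  map_add' x y := by
    ext i
    simp [functionalVec, functional_eq_inner (hpsi i), inner_add_right]
  map_smul' c x := by
    ext i
    simp [functionalVec, functional_eq_inner (hpsi i), inner_smul_right]

theorem functionalVec_sub (hpsi : ∀ i, MemLp (psi i) 2 unitVol) (x y : StateSpace) :
    functionalVec psi (x - y) = functionalVec psi x - functionalVec psi y :=
  map_sub (functionalVecₗ hpsi) x y

theorem feedback_eq (K : Matrix (Fin 2) (Fin n) ℝ) (x : StateSpace) (k : Fin 2) :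
    feedback K psi x k = -complexMulVec K (functionalVec psi x) k := by
  simp [feedback, complexMulVec_apply, functionalVec]

end Feedback

namespace ParabolicPlant.IsEigensystem

variable {P : ParabolicPlant} {lam : ℕ → ℝ} {phi : ℕ → ℝ → ℝ} (hsys : P.IsEigensystem lam phi)
  {n : ℕ} {psi : Fin n → ℝ → ℝ} (hpsi : ∀ i, MemLp (psi i) 2 unitVol)

/-- The synthesis map `v ↦ ∑ v_j φ_j`. -/
def synthesis (n : ℕ) : EuclideanSpace ℂ (Fin n) →ₗ[ℂ] StateSpace where
  toFun v := ∑ j : Fin n, v j • hsys.basis j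
  map_add' v w := by simp [add_smul, Finset.sum_add_distrib]
  map_smul' c v := by simp [mul_smul, Finset.smul_sum]

theorem functionalVec_synthesis (v : EuclideanSpace ℂ (Fin n)) :
    functionalVec (fun i : Fin n => phi i) (hsys.synthesis n v) = v := by
  ext i
  simp only [functionalVec, synthesis, LinearMap.coe_mk, AddHom.coe_mk]
  rw [hsys.functional_eq, inner_sum]
  simp only [inner_smul_right, orthonormal_iff_ite.1 hsys.basis.orthonormal, Fin.val_inj]
  simp

/-- The matrix of estimated observables of the first `n` eigenfunctions, as an operator. -/
def estimateMap : EuclideanSpace ℂ (Fin n) →L[ℂ] EuclideanSpace ℂ (Fin n) :=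
  (functionalVecₗ hpsi ∘ₗ hsys.synthesis n).toContinuousLinearMap

theorem norm_sub_estimateMap_le {c : ℝ}
    (hphi : ∀ x : StateSpace, ‖functionalVec (fun i : Fin n => phi i) x - functionalVec psi x‖
        ≤ c * ‖functionalVec (fun i : Fin n => phi i) x‖) (v : EuclideanSpace ℂ (Fin n)) :
    ‖v - hsys.estimateMap hpsi v‖ ≤ c * ‖v‖ := by
  have h := hphi (hsys.synthesis n v)
  rwa [hsys.functionalVec_synthesis] at h

/-- Removing from x its projection onto the first n modes makes the right side of the relative bound
zero, so the estimated observables do not see the remainder. -/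
theorem functionalVec_eq_estimateMap {c : ℝ}
    (hphi : ∀ x : StateSpace, ‖functionalVec (fun i : Fin n => phi i) x - functionalVec psi x‖
        ≤ c * ‖functionalVec (fun i : Fin n => phi i) x‖) (x : StateSpace) :
    functionalVec psi x = hsys.estimateMap hpsi (functionalVec (fun i : Fin n => phi i) x) := by
  have hmem : ∀ i : Fin n, MemLp (phi i) 2 unitVol := fun i => hsys.memLp i
  have h := hphi (x - hsys.synthesis n (functionalVec (fun i : Fin n => phi i) x))
  rw [functionalVec_sub hmem, functionalVec_sub hpsi, hsys.functionalVec_synthesis, sub_self,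
    zero_sub, norm_neg, norm_zero, mul_zero] at h
  exact sub_eq_zero.1 (norm_le_zero_iff.1 h)

theorem norm_functionalVec_le (hsys : P.IsEigensystem lam phi) (x : StateSpace) :
    ‖functionalVec (fun i : Fin n => phi i) x‖ ≤ ‖x‖ := by
  refine le_of_sq_le_sq ?_ (norm_nonneg _)
  rw [EuclideanSpace.norm_sq_eq]
  simp only [functionalVec, hsys.functional_eq]
  rw [Fin.sum_univ_eq_sum_range fun i => ‖inner ℂ (hsys.basis i) x‖ ^ 2]
  exact sum_le_hasSum _ (fun i _ => by positivity) (hsys.basis.hasSum_norm_sq x)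

end ParabolicPlant.IsEigensystem

/-- The modal right-hand sides of the first `n` modes, in matrix form. -/
theorem complexMulVec_closedLoop_apply {n : ℕ} (rho : ℝ) (lam : ℕ → ℝ) (phi : ℕ → ℝ → ℝ)
    (K : Matrix (Fin 2) (Fin n) ℝ) (v w : EuclideanSpace ℂ (Fin n)) (i : Fin n) :
    (complexMulVec (Matrix.diagonal fun i : Fin n => lam i) v
      - complexMulVec (inputMatrix rho (fun i : Fin n => phi i) * K) w) i
      = (lam i : ℂ) * v i + ∑ k, (inputVec rho (phi i) k : ℂ) * (-complexMulVec K w k) := by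
  rw [complexMulVec_mul, PiLp.sub_apply, complexMulVec_apply, complexMulVec_apply, sub_eq_add_neg]
  congr 1
  · simp [Matrix.diagonal_apply, apply_ite (Complex.ofReal)]
  · simp [inputMatrix]

end

/-! ### Assembly: existence, uniqueness and decay for the closed loop. -/

theorem theorem4 (P : ParabolicPlant)
    (lam : ℕ → ℝ) (phi : ℕ → ℝ → ℝ) (hsys : P.IsEigensystem lam phi)
    (n : ℕ) (hn : 1 ≤ n)
    (lamhat : Fin n → ℝ) (phihat : Fin n → ℝ → ℝ) (rhohat : ℝ)
    (hphihat : ∀ i, MeasureTheory.MemLp (phihat i) 2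
      (MeasureTheory.volume.restrict (Set.Ioo (0 : ℝ) 1)))
    (K : Matrix (Fin 2) (Fin n) ℝ)
    (L Lhat : Matrix (Fin n) (Fin n) ℝ) (B Bhat : Matrix (Fin n) (Fin 2) ℝ)
    (hL : L = Matrix.diagonal fun i : Fin n => lam i)
    (hLhat : Lhat = Matrix.diagonal lamhat)
    (hB : B = inputMatrix P.rho fun i : Fin n => phi i)
    (hBhat : Bhat = inputMatrix rhohat phihat)
    (hHurwitz : IsHurwitz (Lhat - Bhat * K))
    (Pi : Matrix (Fin n) (Fin n) ℝ) (hPi : Pi.PosDef)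
    (hLyap : (Lhat - Bhat * K).transpose * Pi + Pi * (Lhat - Bhat * K) = -1)
    (c : ℝ) (hc : 0 < c)
    (hphi : ∀ x : StateSpace,
      ‖functionalVec (fun i : Fin n => phi i) x - functionalVec phihat x‖
        ≤ c * ‖functionalVec (fun i : Fin n => phi i) x‖)
    (alpha : ℝ) (halpha : alpha = gammaConst L Lhat B Bhat K Pi c / (2 * lambdaMax Pi))
    (halpha_neg : alpha < 0) (hlam : ∀ i, n ≤ i → lam i < alpha) :
    ∃ M : ℝ, 1 ≤ M ∧ ∀ x0 : StateSpace, ∃ x : ℝ → StateSpace,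
      IsWeakSolution P K phihat x0 x ∧
      IsModalSolution P lam phi K phihat x0 x ∧
      (∀ y : ℝ → StateSpace, IsModalSolution P lam phi K phihat x0 y →
        ∀ t : ℝ, 0 ≤ t → y t = x t) ∧
      ∀ t : ℝ, 0 ≤ t → ‖x t‖ ≤ M * Real.exp (alpha * t) * ‖x0‖ := by
  have hT := fun v => lyapunov_inequality (L := L) (B := B) hn hPi hLyap
    (hsys.norm_sub_estimateMap_le hphihat hphi v)
  set S := hsys.estimateMap hphihat with hS
  set T : EuclideanSpace ℂ (Fin n) →L[ℂ] EuclideanSpace ℂ (Fin n) :=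
    complexMulVec L - (complexMulVec (B * K)).comp S with hTdef
  have hTi : ∀ v (i : Fin n), T v i = (lam i : ℂ) * v i
      + ∑ k, (inputVec P.rho (phi i) k : ℂ) * (-complexMulVec K (S v) k) := by
    intro v i
    rw [← complexMulVec_closedLoop_apply, ← hL, ← hB]
    rfl
  have hest : ∀ x, functionalVec phihat x = S (functionalVec (fun i : Fin n => phi i) x) :=
    hsys.functionalVec_eq_estimateMap hphihat hphi
  obtain ⟨C, hC0, hC⟩ := exists_decay_of_lyapunov (T := T) hn hPi halpha halpha_neg hT
  -- Indices start at 0, so `lam n` is the largest eigenvalue outside the controlled block;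
  -- monotonicity makes this gap uniform over the tail.
  have hδ : 0 < alpha - lam n := sub_pos.2 (hlam n le_rfl)
  obtain ⟨M, hM1, hM⟩ := hsys.basis.exists_modal_trajectory (lam := lam)
    (b := fun i k => (inputVec P.rho (phi i) k : ℂ)) (fun i k => hsys.inputVec_eq_inner i k)
    (n := n) halpha_neg.le hδ
    (fun i hi => by have := hsys.strictAnti.antitone hi; linarith)
    (C := C) (C' := ‖K‖ * (‖S‖ * C)) (by positivity)
  refine ⟨M, hM1, fun x0 => ?_⟩
  obtain ⟨p, hp0, hp⟩ := exists_linear_flow T (functionalVec (fun i : Fin n => phi i) x0)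
  have hpc : Continuous p := continuous_iff_continuousAt.2 fun t => (hp t).continuousAt
  have hpb : ∀ t, 0 ≤ t → ‖p t‖ ≤ C * Real.exp (alpha * t) * ‖x0‖ := fun t ht => by
    refine (hC p hpc.continuousOn (fun t _ => hp t) t ht).trans ?_
    rw [hp0]
    gcongr
    exact hsys.norm_functionalVec_le x0
  -- The input is read off the finite-dimensional flow before a state curve exists; `hxu` identifies
  -- it with the feedback afterwards.
  set u : Fin 2 → ℝ → ℂ := fun k t => -complexMulVec K (S (p t)) k with hu
  have huc : ∀ k, Continuous (u k) := fun k => by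
    have h1 : Continuous fun t => complexMulVec K (S (p t)) :=
      (complexMulVec K).continuous.comp (S.continuous.comp hpc)
    exact ((EuclideanSpace.proj (𝕜 := ℂ) k).continuous.comp h1).neg
  have hub : ∀ k t, 0 ≤ t → ‖u k t‖ ≤ ‖K‖ * (‖S‖ * C) * Real.exp (alpha * t) * ‖x0‖ := by
    intro k t ht
    calc ‖u k t‖ ≤ ‖complexMulVec K (S (p t))‖ := by
          rw [hu, norm_neg]; exact PiLp.norm_apply_le _ k
      _ ≤ ‖K‖ * (‖S‖ * (C * Real.exp (alpha * t) * ‖x0‖)) := by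
          refine (norm_complexMulVec_le _ _).trans ?_
          gcongr
          exact (S.le_opNorm _).trans (by gcongr; exact hpb t ht)
      _ = _ := by ring
  have hfc : ∀ i, Continuous fun s => ∑ k, (inputVec P.rho (phi i) k : ℂ) * u k s := fun i =>
    continuous_finsetSum _ fun k _ => continuous_const.mul (huc k)
  have hpi : ∀ (i : Fin n) t, 0 ≤ t → p t i = varConst (lam i) (inner ℂ (hsys.basis i) x0)
      (fun s => ∑ k, (inputVec P.rho (phi i) k : ℂ) * u k s) t := by
    intro i t ht
    have h1 : ∀ t, HasDerivAt (fun t => p t i) (T (p t) i) t := fun t =>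
      ((EuclideanSpace.proj (𝕜 := ℂ) i).restrictScalars ℝ).hasFDerivAt.comp_hasDerivAt t (hp t)
    have h2 := eq_varConst (y := fun t => p t i) (l := lam i) (hfc i)
      (fun t _ => (h1 t).continuousAt.continuousWithinAt)
      (fun t _ => by have := h1 t; rwa [hTi] at this) ht
    rw [h2]
    congr 1
    rw [hp0, ← hsys.functional_eq]
    rfl
  obtain ⟨x, hxc, hx, hxb, hxw⟩ := hM x0 u huc hub (fun i hi t ht => by
    rw [← hpi ⟨i, hi⟩ t ht]
    exact (PiLp.norm_apply_le _ _).trans (hpb t ht))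
  have hxp : ∀ t, 0 ≤ t → functionalVec (fun i : Fin n => phi i) (x t) = p t := by
    intro t ht
    ext i
    rw [hpi i t ht, ← hx i t ht, ← hsys.functional_eq]
    rfl
  have hxu : ∀ k t, 0 ≤ t → feedback K phihat (x t) k = u k t := by
    intro k t ht
    rw [feedback_eq, hest, hxp t ht]
  have hx0 : x 0 = x0 := hsys.basis.ext_inner fun i => by rw [hx i 0 le_rfl, varConst_zero]
  refine ⟨x, ⟨hx0, hxc, ?_⟩, ⟨hx0, hxc, ?_⟩, ?_, hxb⟩
  · intro h dh ddh H t ht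
    have h1 := hxw (complexify H.toIsH2.continuousOn.memLp_unitVol)
      (complexify (P.memLp_opA H.toIsH2)) (hsys.inner_opA H) t ht
    simp only [← ParabolicPlant.inputVec_eq_inner H] at h1
    simp only [← functional_eq_inner] at h1
    simp only [hxu _ t ht.le]
    exact h1
  · intro i t ht
    simp only [hxu _ t ht.le, hsys.functional_eq, hx i t ht.le]
    refine (hasDerivAt_varConst _ _ (hfc i) t).congr_of_eventuallyEq ?_
    filter_upwards [lt_mem_nhds ht] with s hs
    exact hx i s hs.le
  · intro y hy t ht
    have hyi : ∀ i, ContinuousOn (fun t => functional (phi i) (y t)) (Set.Ici 0) := fun i => by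
      simp only [hsys.functional_eq]
      exact continuousOn_const.inner hy.continuousOn
    have hq : ∀ t, 0 ≤ t → functionalVec (fun i : Fin n => phi i) (y t) = p t := by
      intro t ht
      -- The difference solves the same linear system from zero, so the decay estimate forces it to
      -- vanish.
      have hd := hC (fun t => functionalVec (fun i : Fin n => phi i) (y t) - p t) ?_ ?_ t ht
      · simp only [hy.initial, hp0, sub_self, norm_zero, mul_zero] at hd
        exact sub_eq_zero.1 (norm_le_zero_iff.1 hd)
      · refine ContinuousOn.sub ?_ hpc.continuousOn
        exact (PiLp.continuous_toLp 2 _).comp_continuousOn (continuousOn_pi.2 fun i => hyi i)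
      · intro s hs
        rw [map_sub]
        refine HasDerivAt.sub ?_ (hp s)
        have hpi' : HasDerivAt (fun t (i : Fin n) => functional (phi i) (y t))
            (WithLp.ofLp (T (functionalVec (fun i : Fin n => phi i) (y s)))) s := ?_
        · exact (PiLp.hasFDerivAt_toLp (𝕜 := ℝ) 2 _).comp_hasDerivAt s hpi'
        rw [hasDerivAt_pi]
        intro i
        have h1 := hy.modal i s hs
        simp only [feedback_eq, hest] at h1
        rw [hTi]
        exact h1
    refine hsys.basis.ext_inner fun i => ?_
    rw [hx i t ht, ← hsys.functional_eq, ← hy.initial, ← hsys.functional_eq]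
    refine eq_varConst (hfc i) (hyi i) (fun s hs => ?_) ht
    have h1 := hy.modal i s hs
    simp only [feedback_eq, hest, hq s hs.le] at h1
    exact h1
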